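/- Let $G=(V,E)$ be an unknown connected unweighted graph on $n=|V|$ vertices that can be accessed only through a distance oracle, which on a query $(u,v)\in V^2$ returns the distance $\delta(u,v)$ in $G$. In the verification problem one is given a connected graph $\hat G=(V,\hat E)$, with distance function $\hat\delta$, and has to decide whether $\hat G=G$. For $(u,v)\in V^2$ let $S_{u,v}$ be the set of non-edges $\{a,b\}$ of $\hat G$ (unordered pairs of distinct non-adjacent vertices) with $\hat\delta(u,a)+\hat\delta(b,v)+1<\hat\delta(u,v)$, for one of the two ways of naming the endpoints. The greedy verification algorithm first queries every edge of $\hat G$, and answers "no" if some reply differs from the distance in $\hat G$. Otherwise it sets $Y=\emptyset$ and, while $\hat E\cup Y$ does not contain all unordered pairs of distinct vertices, it queries a pair $(u,v)$ that maximizes $|S_{u,v}\setminus Y|$; if $\delta(u,v)=\hat\delta(u,v)$ it replaces $Y$ by $Y\cup S_{u,v}$, and otherwise it answers "no". When the loop ends it answers "yes". **Theorem.** Let $\Delta$ be the maximum degree and $\mathrm{tw}$ the treewidth of the given graph $\hat G$. For every order of the edge queries and every deterministic tie-breaking rule in the greedy choices, the greedy verification algorithm is a deterministic algorithm that always halts and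 answers "yes" if and only if $\hat G=G$. The number of its queries satisfies the following bounds, in which all implied constants and $o(1)$ terms are uniform over $G$, $\hat G$, the edge order and the tie-breaking rule. 1. For $n\ge 3$ it is at most $n^{1+O\left(\sqrt{(\log\log n+\log\Delta)/\log n}\right)}$, with an absolute implied constant. In particular it is $n^{1+o(1)}$ when $\Delta=n^{o(1)}$. 2. It is $O\big(\Delta(\Delta+\mathrm{tw}\cdot\log n)\,n\log^2 n\big)$, with an absolute implied constant. In particular it is $n\cdot(\log n)^{O(1)}$ when $\Delta$ and $\mathrm{tw}$ are $(\log n)^{O(1)}$. -/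

import Mathlib

open Filter Topology Asymptotics

universe u

/-! ### Deterministic algorithms with access to an oracle -/

/-- A deterministic algorithm that accesses an unknown object only through an oracle answering
queries `(u, v) ∈ V²` by natural numbers, and that may finally return a yes/no answer.
In each state it either returns an answer (`Sum.inl`) or issues one query (`Sum.inr`), after which
its next state depends on the current state and on the oracle's reply only. -/
structure QueryAlgorithm (V : Type u) where
  State : Type u
  start : State
  action : State → Bool ⊕ (V × V)
  next : State → ℕ → State

/-- `A.ReturnsFrom oracle s q ans`: started in state `s`, the algorithm halts after exactly `q`
queries to the oracle (repetitions counted) and returns `ans`. -/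
inductive QueryAlgorithm.ReturnsFrom {V : Type u} (A : QueryAlgorithm V) (oracle : V → V → ℕ) :
    A.State → ℕ → Bool → Prop
  | halt {s : A.State} {ans : Bool} (h : A.action s = Sum.inl ans) : ReturnsFrom A oracle s 0 ans
  | query {s : A.State} {p : V × V} {q : ℕ} {ans : Bool} (h : A.action s = Sum.inr p)
      (hr : ReturnsFrom A oracle (A.next s (oracle p.1 p.2)) q ans) :
      ReturnsFrom A oracle s (q + 1) ans

/-- The algorithm halts, from its start state, after exactly `q` queries, with answer `ans`. -/
def QueryAlgorithm.Returns {V : Type u} (A : QueryAlgorithm V) (oracle : V → V → ℕ)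
    (q : ℕ) (ans : Bool) : Prop :=
  A.ReturnsFrom oracle A.start q ans

/-! ### Greedy verification -/

/-- `S_{u,v}`, for `p = (u, v)`: the non-edges `{a, b}` of the hypothetical graph `H` with
`δ_H(u, a) + δ_H(b, v) + 1 < δ_H(u, v)` for one of the two ways of naming their endpoints.
The non-edges (unordered pairs of distinct non-adjacent vertices) are the edges of `Hᶜ`. -/
def confirmedNonEdges {V : Type u} (H : SimpleGraph V) (p : V × V) : Set (Sym2 V) :=
  {e | e ∈ Hᶜ.edgeSet ∧
    ∃ a b : V, e = s(a, b) ∧ H.dist p.1 a + H.dist b p.2 + 1 < H.dist p.1 p.2}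

/-- What the greedy algorithm leaves open: the order in which the edges of `H` are queried (each
edge once, in one of its two orientations), and a tie-breaking rule, which selects, given the
set `Y` of non-edges confirmed so far, a pair `(u, v)` that maximizes `|S_{u,v} \ Y|`. -/
structure GreedyRule {V : Type u} (H : SimpleGraph V) where
  edgeOrder : List (V × V)
  nodup : (edgeOrder.map fun p => s(p.1, p.2)).Nodup
  mem_iff : ∀ e : Sym2 V, e ∈ edgeOrder.map (fun p => s(p.1, p.2)) ↔ e ∈ H.edgeSet
  pick : Set (Sym2 V) → V × V
  pick_max : ∀ (Y : Set (Sym2 V)) (p : V × V),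
    (confirmedNonEdges H p \ Y).ncard ≤ (confirmedNonEdges H (pick Y) \ Y).ncard

/-- Rules exist, so that quantifying over all of them is not vacuous. -/
theorem GreedyRule.nonempty {V : Type u} [Finite V] [Nonempty V] (H : SimpleGraph V) :
    Nonempty (GreedyRule H) := by
  classical
  have hmap : (fun p : V × V => s(p.1, p.2)) ∘ (Quot.out : Sym2 V → V × V) = id := by
    funext e
    exact Quot.out_eq e
  have hfin : H.edgeSet.Finite := Set.toFinite _
  choose f hf using fun Y : Set (Sym2 V) =>
    Finite.exists_max fun p : V × V => (confirmedNonEdges H p \ Y).ncard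
  exact ⟨{
    edgeOrder := hfin.toFinset.toList.map Quot.out
    nodup := by
      rw [List.map_map, hmap, List.map_id]
      exact Finset.nodup_toList _
    mem_iff := fun e => by
      rw [List.map_map, hmap, List.map_id]
      simp
    pick := f
    pick_max := hf }⟩

/-- State of the greedy algorithm: the edges of `H` still to be queried, whether all replies so far
agreed with the distances in `H`, and the set `Y` of confirmed non-edges. -/
structure GreedyState (V : Type u) where
  todo : List (V × V)
  consistent : Bool
  Y : Set (Sym2 V)

open Classical in
/-- The greedy verification algorithm for the hypothetical graph `H`. It queries all edges of `H`
and returns no (`false`) if some reply is wrong. Then, as long as the edges of `H` and the set `Y`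
do not cover all vertex pairs, it queries a pair `(u, v)` maximizing `|S_{u,v} \ Y|`; a wrong reply
makes it return no, a right one adds `S_{u,v}` to `Y`. Finally it returns yes (`true`). -/
noncomputable def greedyVerify {V : Type u} {H : SimpleGraph V} (R : GreedyRule H) :
    QueryAlgorithm V where
  State := GreedyState V
  start := { todo := R.edgeOrder, consistent := true, Y := ∅ }
  action s :=
    match s.todo with
    | p :: _ => Sum.inr p
    | [] =>
      if s.consistent = false then Sum.inl false
      else if ∀ a b : V, a ≠ b → s(a, b) ∈ H.edgeSet ∪ s.Y then Sum.inl true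
      else Sum.inr (R.pick s.Y)
  next s d :=
    match s.todo with
    | p :: rest =>
      { todo := rest, consistent := s.consistent && decide (d = H.dist p.1 p.2), Y := s.Y }
    | [] =>
      if d = H.dist (R.pick s.Y).1 (R.pick s.Y).2 then
        { todo := [], consistent := s.consistent, Y := s.Y ∪ confirmedNonEdges H (R.pick s.Y) }
      else { todo := [], consistent := false, Y := s.Y }

/-! ### Treewidth -/

/-- A tree decomposition of the graph `G`: a tree with nodes `0, …, numNodes - 1`, each carrying a
bag of vertices. A connected graph is nonempty, so every vertex lies in some bag. -/
structure TreeDecomposition {V : Type u} (G : SimpleGraph V) where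
  numNodes : ℕ
  tree : SimpleGraph (Fin numNodes)
  isTree : tree.IsTree
  bag : Fin numNodes → Finset V
  connected : ∀ v : V, (tree.induce {i | v ∈ bag i}).Connected
  edge_mem : ∀ a b : V, G.Adj a b → ∃ i, a ∈ bag i ∧ b ∈ bag i

/-- The size of the largest bag minus 1. -/
def TreeDecomposition.width {V : Type u} {G : SimpleGraph V} (T : TreeDecomposition G) : ℕ :=
  (Finset.univ.sup fun i => (T.bag i).card) - 1

/-- The treewidth of a graph with finitely many vertices: the least width of a tree
decomposition. -/
noncomputable def treewidth {V : Type u} (G : SimpleGraph V) : ℕ :=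
  sInf (Set.range fun T : TreeDecomposition G => T.width)

/-! ### Correctness and running time of the greedy algorithm -/

/-! Correctness. Right replies on all edges of `H` give `H ≤ G`, so distances in `G` are at most
those in `H`. If then `(u, v)` also gets the right reply, no pair in `S_{u,v}` can be an edge of
`G`, since it would create a shortcut. An unconfirmed non-edge `ab` lies in `S_{a,b}`, so every
greedy query makes progress and the loop ends (`greedy_loop_correct`).

Counting. The loop is greedy set cover: if some set `Q` of queries confirms all non-edges, the
greedy choice confirms at least a `1/|Q|` fraction of the open ones, so the loop makes at most `1 +
|Q| log(#non-edges)` queries (`queries_le_of_cover`). It remains to find a small `Q`, a question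
about `H` alone. A query `(b, v)` confirms `uv` as soon as `b` is closer to `u` than to `v` by at
least 2.

Bounded degree. Choose about `s log n` centers whose Voronoi cells contain at most a `1/s` fraction
of `U` (`exists_centers`). Take a center nearest to `{u, v}`, say nearest to `u`, and go two steps
from it towards `u`, to `b`. Either `(b, v)` confirms `uv`, or `u` and `v` both lie in the cell of
`b` (`confirmed_or_mem_voronoiCell`). Recursing into these overlapping cells costs a factor `O(Δ²
log n)` per level, over `log_s n` levels; `s` is chosen to balance the two effects.

Bounded treewidth. Some bag splits `U` into parts of at most half its size
(`TreeDecomposition.exists_balanced_bag`). Non-edges across the bag are confirmed by queries from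
its neighbours (`confirmed_of_separated`), and the recursion goes into disjoint parts, to
logarithmic depth. -/

theorem confirmedNonEdges_subset {V : Type u} (H : SimpleGraph V) (p : V × V) :
    confirmedNonEdges H p ⊆ Hᶜ.edgeSet := fun _ h => h.1

/-- The query sets constructed below rely on this case only: the query ends at an endpoint of the
non-edge, so one of the two distances vanishes. -/
theorem mem_confirmedNonEdges_of_dist {V : Type u} {H : SimpleGraph V} {w a b : V}
    (hab : a ≠ b) (hadj : ¬ H.Adj a b) (h : H.dist w a + 1 < H.dist w b) :
    s(a, b) ∈ confirmedNonEdges H (w, b) :=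
  ⟨by simp [hab, hadj], a, b, rfl, by simpa using h⟩

theorem mem_confirmedNonEdges_self {V : Type u} {H : SimpleGraph V} (hH : H.Connected) {a b : V}
    (hab : a ≠ b) (hadj : ¬ H.Adj a b) : s(a, b) ∈ confirmedNonEdges H (a, b) :=
  mem_confirmedNonEdges_of_dist hab hadj (by simpa using hH.one_lt_dist_of_ne_of_not_adj hab hadj)

/-- A correct reply to the query `p` rules out that a pair in `S_p` is an edge of the hidden
graph. -/
theorem confirmedNonEdges_disjoint {V : Type u} {G H : SimpleGraph V} (hG : G.Connected)
    (hH : H.Connected) (hle : H ≤ G) {p : V × V} (hp : G.dist p.1 p.2 = H.dist p.1 p.2) :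
    Disjoint (confirmedNonEdges H p) G.edgeSet := by
  rw [Set.disjoint_left]
  rintro _ ⟨-, a, b, rfl, h⟩ hab
  -- An edge `ab` of `G` would give a walk from `p.1` through `a`, `b` to `p.2` shorter than `H.dist
  -- p.1 p.2`.
  have hd : ∀ x y, G.dist x y ≤ H.dist x y := fun x y => (hH x y).dist_anti hle
  have h1 : G.dist a b = 1 := SimpleGraph.dist_eq_one_iff_adj.2 hab
  have h2 := hG.dist_triangle (u := p.1) (v := a) (w := p.2)
  have h3 := hG.dist_triangle (u := a) (v := b) (w := p.2)
  have h4 := hd p.1 a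
  have h5 := hd b p.2
  omega

/-- The number of non-edges not confirmed yet. -/
noncomputable def openCount {V : Type u} (H : SimpleGraph V) (Y : Set (Sym2 V)) : ℕ :=
  (Hᶜ.edgeSet \ Y).ncard

theorem openCount_union {V : Type u} [Finite V] (H : SimpleGraph V) (Y : Set (Sym2 V))
    (p : V × V) :
    openCount H (Y ∪ confirmedNonEdges H p) + (confirmedNonEdges H p \ Y).ncard =
      openCount H Y := by
  have hsub : confirmedNonEdges H p \ Y ⊆ Hᶜ.edgeSet \ Y :=
    Set.sdiff_subset_sdiff_left (confirmedNonEdges_subset H p)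
  have := Set.ncard_sdiff_add_ncard_of_subset hsub (Set.toFinite _)
  rw [openCount, openCount, ← this]
  congr 2
  ext e
  simp only [Set.mem_sdiff, Set.mem_union]
  tauto

theorem exists_open_of_not_covered {V : Type u} {H : SimpleGraph V} {Y : Set (Sym2 V)}
    (h : ¬ ∀ a b : V, a ≠ b → s(a, b) ∈ H.edgeSet ∪ Y) :
    ∃ a b : V, a ≠ b ∧ ¬ H.Adj a b ∧ s(a, b) ∉ Y := by
  push Not at h
  obtain ⟨a, b, hab, h⟩ := h
  simp only [Set.mem_union, SimpleGraph.mem_edgeSet, not_or] at h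
  exact ⟨a, b, hab, h.1, h.2⟩

theorem openCount_pos {V : Type u} [Finite V] {H : SimpleGraph V} {Y : Set (Sym2 V)}
    (h : ¬ ∀ a b : V, a ≠ b → s(a, b) ∈ H.edgeSet ∪ Y) : 0 < openCount H Y := by
  obtain ⟨a, b, hab, hadj, hY⟩ := exists_open_of_not_covered h
  exact (Set.ncard_pos (Set.toFinite _)).2 ⟨s(a, b), by simp [hab, hadj], hY⟩

/-- The greedy choice makes at least the average progress of any covering family of queries. -/
theorem openCount_le_card_mul {V : Type u} [Finite V] {H : SimpleGraph V} (R : GreedyRule H)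
    {Q : Finset (V × V)}
    (hQ : ∀ a b : V, a ≠ b → ¬ H.Adj a b → ∃ p ∈ Q, s(a, b) ∈ confirmedNonEdges H p)
    (Y : Set (Sym2 V)) :
    openCount H Y ≤ Q.card * (confirmedNonEdges H (R.pick Y) \ Y).ncard := by
  have hsub : Hᶜ.edgeSet \ Y ⊆ ⋃ p ∈ Q, (confirmedNonEdges H p \ Y) := by
    rintro e ⟨he, hY⟩
    induction e using Sym2.ind with
    | _ a b =>
      rw [SimpleGraph.mem_edgeSet, SimpleGraph.compl_adj] at he
      obtain ⟨p, hp, hm⟩ := hQ a b he.1 he.2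
      simp only [Set.mem_iUnion]
      exact ⟨p, hp, hm, hY⟩
  calc openCount H Y ≤ (⋃ p ∈ Q, (confirmedNonEdges H p \ Y)).ncard :=
        Set.ncard_le_ncard hsub (Set.toFinite _)
    _ ≤ ∑ p ∈ Q, (confirmedNonEdges H p \ Y).ncard := Finset.set_ncard_biUnion_le _ _
    _ ≤ ∑ _p ∈ Q, (confirmedNonEdges H (R.pick Y) \ Y).ncard :=
        Finset.sum_le_sum fun p _ => R.pick_max Y p
    _ = _ := by simp

/-- The query `(a, b)` confirms an open non-edge `ab`, and the greedy pick gains at least as much.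
-/
theorem gain_pos {V : Type u} [Finite V] {H : SimpleGraph V} (hH : H.Connected)
    (R : GreedyRule H) {Y : Set (Sym2 V)}
    (h : ¬ ∀ a b : V, a ≠ b → s(a, b) ∈ H.edgeSet ∪ Y) :
    0 < (confirmedNonEdges H (R.pick Y) \ Y).ncard := by
  obtain ⟨a, b, hab, hadj, hY⟩ := exists_open_of_not_covered h
  refine lt_of_lt_of_le ?_ (R.pick_max Y (a, b))
  exact (Set.ncard_pos (Set.toFinite _)).2 ⟨s(a, b), mem_confirmedNonEdges_self hH hab hadj, hY⟩

/-! ### Single transitions of the algorithm -/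

section Runs

variable {V : Type u} {H : SimpleGraph V} (R : GreedyRule H)

theorem greedy_action_edge (p : V × V) (l : List (V × V)) (c : Bool) (Y : Set (Sym2 V)) :
    (greedyVerify R).action ⟨p :: l, c, Y⟩ = Sum.inr p := rfl

theorem greedy_next_edge (p : V × V) (l : List (V × V)) (c : Bool) (Y : Set (Sym2 V)) (d : ℕ) :
    (greedyVerify R).next ⟨p :: l, c, Y⟩ d = ⟨l, c && decide (d = H.dist p.1 p.2), Y⟩ := rfl

theorem greedy_action_inconsistent (Y : Set (Sym2 V)) :
    (greedyVerify R).action ⟨[], false, Y⟩ = Sum.inl false := by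
  simp [greedyVerify]

theorem greedy_action_done {Y : Set (Sym2 V)}
    (h : ∀ a b : V, a ≠ b → s(a, b) ∈ H.edgeSet ∪ Y) :
    (greedyVerify R).action ⟨[], true, Y⟩ = Sum.inl true := by
  simp only [greedyVerify]
  rw [if_neg (by simp), if_pos h]

theorem greedy_action_loop {Y : Set (Sym2 V)}
    (h : ¬ ∀ a b : V, a ≠ b → s(a, b) ∈ H.edgeSet ∪ Y) :
    (greedyVerify R).action ⟨[], true, Y⟩ = Sum.inr (R.pick Y) := by
  simp only [greedyVerify]
  rw [if_neg (by simp), if_neg h]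

theorem greedy_next_right (c : Bool) (Y : Set (Sym2 V)) {d : ℕ}
    (h : d = H.dist (R.pick Y).1 (R.pick Y).2) :
    (greedyVerify R).next ⟨[], c, Y⟩ d = ⟨[], c, Y ∪ confirmedNonEdges H (R.pick Y)⟩ := by
  simp only [greedyVerify]
  rw [if_pos h]

theorem greedy_next_wrong (c : Bool) (Y : Set (Sym2 V)) {d : ℕ}
    (h : d ≠ H.dist (R.pick Y).1 (R.pick Y).2) :
    (greedyVerify R).next ⟨[], c, Y⟩ d = ⟨[], false, Y⟩ := by
  simp only [greedyVerify]
  rw [if_neg h]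

end Runs

/-- The main loop halts with the right answer. -/
theorem greedy_loop_correct {V : Type u} [Finite V] {G H : SimpleGraph V} (hG : G.Connected)
    (hH : H.Connected) (hle : H ≤ G) (R : GreedyRule H) (Y : Set (Sym2 V))
    (hY : Disjoint Y G.edgeSet) :
    ∃ (q : ℕ) (ans : Bool),
      (greedyVerify R).ReturnsFrom G.dist ⟨[], true, Y⟩ q ans ∧ (ans = true ↔ H = G) := by
  induction hm : openCount H Y using Nat.strong_induction_on generalizing Y with
  | _ m ih =>
    by_cases hcov : ∀ a b : V, a ≠ b → s(a, b) ∈ H.edgeSet ∪ Y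
    · refine ⟨0, true, .halt (greedy_action_done R hcov),
        iff_of_true rfl (le_antisymm hle ?_)⟩
      intro a b hab
      rcases hcov a b hab.ne with h | h
      · exact h
      · exact absurd hab (Set.disjoint_left.1 hY h)
    · by_cases hr : G.dist (R.pick Y).1 (R.pick Y).2 = H.dist (R.pick Y).1 (R.pick Y).2
      · have h1 := openCount_union H Y (R.pick Y)
        have h2 := gain_pos hH R hcov
        obtain ⟨q, ans, hq, hans⟩ := ih _ (by omega) (Y ∪ confirmedNonEdges H (R.pick Y))
          (Set.disjoint_union_left.2 ⟨hY, confirmedNonEdges_disjoint hG hH hle hr⟩) rfl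
        refine ⟨q + 1, ans, .query (greedy_action_loop R hcov) ?_, hans⟩
        rwa [greedy_next_right R _ _ hr]
      · refine ⟨1, false, .query (greedy_action_loop R hcov) ?_, by
          simp only [Bool.false_eq_true, false_iff]; rintro rfl; exact hr rfl⟩
        rw [greedy_next_wrong R _ _ hr]
        exact .halt (greedy_action_inconsistent R _)

/-- A wrong edge reply only clears the flag; the remaining edges are still queried, hence the exact
count. -/
theorem greedy_inconsistent_halts {V : Type u} {H : SimpleGraph V} (R : GreedyRule H)
    (oracle : V → V → ℕ) (Y : Set (Sym2 V)) (l : List (V × V)) :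
    (greedyVerify R).ReturnsFrom oracle ⟨l, false, Y⟩ l.length false := by
  induction l with
  | nil => exact .halt (greedy_action_inconsistent R _)
  | cons p l ih =>
    refine .query (greedy_action_edge R p l false Y) ?_
    rw [greedy_next_edge]
    exact ih

/-- While the edges are queried, the algorithm keeps track of whether all replies were right. -/
theorem greedy_edge_phase {V : Type u} {H : SimpleGraph V} (R : GreedyRule H)
    {oracle : V → V → ℕ} {Y : Set (Sym2 V)} {l : List (V × V)} {q : ℕ} {ans : Bool}
    (hl : ∀ p ∈ l, oracle p.1 p.2 = H.dist p.1 p.2)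
    (h : (greedyVerify R).ReturnsFrom oracle ⟨[], true, Y⟩ q ans) :
    (greedyVerify R).ReturnsFrom oracle ⟨l, true, Y⟩ (q + l.length) ans := by
  induction l with
  | nil => exact h
  | cons p l ih =>
    refine .query (greedy_action_edge R p l true Y) ?_
    rw [greedy_next_edge, hl p (by simp)]
    simpa using ih fun p hp => hl p (by simp [hp])

theorem greedy_edge_phase_wrong {V : Type u} {H : SimpleGraph V} (R : GreedyRule H)
    {oracle : V → V → ℕ} {Y : Set (Sym2 V)} {l : List (V × V)}
    (hl : ∃ p ∈ l, oracle p.1 p.2 ≠ H.dist p.1 p.2) :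
    (greedyVerify R).ReturnsFrom oracle ⟨l, true, Y⟩ l.length false := by
  induction l with
  | nil => simp at hl
  | cons p l ih =>
    refine .query (greedy_action_edge R p l true Y) ?_
    rw [greedy_next_edge]
    by_cases hp : oracle p.1 p.2 = H.dist p.1 p.2
    · rw [hp]
      simp only [decide_true, Bool.and_self]
      refine ih ?_
      obtain ⟨p', hp', h⟩ := hl
      rcases List.mem_cons.1 hp' with rfl | h'
      · exact absurd hp h
      · exact ⟨p', h', h⟩
    · rw [decide_eq_false hp]
      exact greedy_inconsistent_halts R oracle Y l

theorem GreedyRule.adj_of_mem {V : Type u} {H : SimpleGraph V} (R : GreedyRule H) {p : V × V}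
    (hp : p ∈ R.edgeOrder) : H.Adj p.1 p.2 := by
  have := (R.mem_iff s(p.1, p.2)).1 (List.mem_map_of_mem hp)
  simpa using this

theorem greedyVerify_correct {V : Type u} [Finite V] {G H : SimpleGraph V} (hG : G.Connected)
    (hH : H.Connected) (R : GreedyRule H) :
    ∃ (q : ℕ) (ans : Bool),
      (greedyVerify R).Returns G.dist q ans ∧ (ans = true ↔ H = G) := by
  by_cases hl : ∀ p ∈ R.edgeOrder, G.dist p.1 p.2 = H.dist p.1 p.2
  · have hle : H ≤ G := by
      intro a b hab
      have hm := (R.mem_iff s(a, b)).2 hab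
      obtain ⟨p, hp, hpe⟩ := List.mem_map.1 hm
      have hd := hl p hp
      rw [SimpleGraph.dist_eq_one_iff_adj.2 (R.adj_of_mem hp),
        SimpleGraph.dist_eq_one_iff_adj] at hd
      have : s(a, b) ∈ G.edgeSet := by rw [← hpe]; exact hd
      exact this
    obtain ⟨q, ans, h, hans⟩ := greedy_loop_correct hG hH hle R ∅ (by simp)
    exact ⟨_, ans, greedy_edge_phase R hl h, hans⟩
  · push Not at hl
    refine ⟨_, false, greedy_edge_phase_wrong R hl, ?_⟩
    simp only [Bool.false_eq_true, false_iff]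
    rintro rfl
    obtain ⟨p, -, hp⟩ := hl
    exact hp rfl

/-- A bound on the number of queries from a bound on the number of queries of the main loop. -/
theorem queries_le_of_loop {V : Type u} {H : SimpleGraph V} (R : GreedyRule H)
    {oracle : V → V → ℕ} {b : Set (Sym2 V) → ℝ} (hb : ∀ Y, 0 ≤ b Y)
    (hstep : ∀ Y, (¬ ∀ a c : V, a ≠ c → s(a, c) ∈ H.edgeSet ∪ Y) →
      ∀ q : ℕ, (q : ℝ) ≤ b (Y ∪ confirmedNonEdges H (R.pick Y)) →
        (q ≠ 0 → ¬ ∀ a c : V, a ≠ c →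
          s(a, c) ∈ H.edgeSet ∪ (Y ∪ confirmedNonEdges H (R.pick Y))) →
        ((q + 1 : ℕ) : ℝ) ≤ b Y)
    {q : ℕ} {ans : Bool} (h : (greedyVerify R).Returns oracle q ans) :
    (q : ℝ) ≤ R.edgeOrder.length + b ∅ := by
  -- The second conjunct says that a loop state with queries left is consistent and has open
  -- non-edges. It supplies the last premise of `hstep`.
  have key : ∀ (s : GreedyState V) (q : ℕ) (ans : Bool),
      (greedyVerify R).ReturnsFrom oracle s q ans →
      (q : ℝ) ≤ s.todo.length + b s.Y ∧ (s.todo = [] → q ≠ 0 → s.consistent = true ∧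
        ¬ ∀ a c : V, a ≠ c → s(a, c) ∈ H.edgeSet ∪ s.Y) := by
    intro s q ans hs
    refine hs.rec (motive := fun (s : GreedyState V) q ans _ =>
      (q : ℝ) ≤ s.todo.length + b s.Y ∧ (s.todo = [] → q ≠ 0 → s.consistent = true ∧
        ¬ ∀ a c : V, a ≠ c → s(a, c) ∈ H.edgeSet ∪ s.Y)) ?_ ?_
    · intro (s : GreedyState V) ans _
      have := hb s.Y
      exact ⟨by push_cast; positivity, by simp⟩
    · intro (s : GreedyState V) p q ans hact hr ih
      obtain ⟨l, c, Y⟩ := s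
      cases l with
      | cons p' l =>
        rw [greedy_next_edge] at ih
        refine ⟨?_, by simp⟩
        have := ih.1
        simp only [List.length_cons] at this ⊢
        push_cast
        linarith
      | nil =>
        cases c with
        | false => rw [greedy_action_inconsistent] at hact; simp at hact
        | true =>
          by_cases hcov : ∀ a b : V, a ≠ b → s(a, b) ∈ H.edgeSet ∪ Y
          · rw [greedy_action_done R hcov] at hact; simp at hact
          · rw [greedy_action_loop R hcov, Sum.inr.injEq] at hact
            subst hact
            refine ⟨?_, fun _ _ => ⟨rfl, hcov⟩⟩
            simp only [List.length_nil, Nat.cast_zero, zero_add]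
            by_cases hr' : oracle (R.pick Y).1 (R.pick Y).2 = H.dist (R.pick Y).1 (R.pick Y).2
            · rw [greedy_next_right R _ _ hr'] at ih
              simp only [List.length_nil, Nat.cast_zero, zero_add, true_imp_iff] at ih
              exact hstep Y hcov q ih.1 fun hq => (ih.2 hq).2
            · rw [greedy_next_wrong R _ _ hr'] at ih
              have hq : q = 0 := by
                by_contra hq
                simpa using ih.2 rfl hq
              subst hq
              exact hstep Y hcov 0 (by simpa using hb _) (by simp)
  exact (key _ q ans h).1

/-- Every loop query confirms a new non-edge, so `openCount` itself serves as the potential. -/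
theorem queries_le_trivial {V : Type u} [Finite V] {H : SimpleGraph V} (hH : H.Connected)
    (R : GreedyRule H) {oracle : V → V → ℕ} {q : ℕ} {ans : Bool}
    (h : (greedyVerify R).Returns oracle q ans) :
    q ≤ R.edgeOrder.length + openCount H ∅ := by
  have := queries_le_of_loop R (b := fun Y => (openCount H Y : ℝ)) (fun Y => by positivity)
    (fun Y hcov q hq _ => by
      have h1 := openCount_union H Y (R.pick Y)
      have h2 := gain_pos hH R hcov
      norm_cast at hq ⊢
      omega) h
  exact_mod_cast this

/-- The set-cover analysis of the greedy algorithm. -/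
theorem queries_le_of_cover {V : Type u} [Finite V] {H : SimpleGraph V}
    (R : GreedyRule H) {oracle : V → V → ℕ} {q : ℕ} {ans : Bool}
    (h : (greedyVerify R).Returns oracle q ans) {Q : Finset (V × V)}
    (hQ : ∀ a b : V, a ≠ b → ¬ H.Adj a b → ∃ p ∈ Q, s(a, b) ∈ confirmedNonEdges H p) :
    (q : ℝ) ≤ R.edgeOrder.length + (1 + Q.card * Real.log (openCount H ∅)) := by
  -- If a query gains `g ≥ u / |Q|` of `u` open non-edges, then `log u` drops by at least `g / u ≥ 1
  -- / |Q|`. The summand 1 pays for the last query, after which nothing may be open and the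
  -- logarithm estimate fails.
  refine queries_le_of_loop R (b := fun Y => 1 + Q.card * Real.log (openCount H Y))
    (fun Y => ?_) (fun Y hcov q hq hne => ?_) h
  · have := Real.log_natCast_nonneg (openCount H Y)
    positivity
  · have hpos := openCount_pos hcov
    rcases Nat.eq_zero_or_pos q with rfl | hq0
    · have := Real.log_natCast_nonneg (openCount H Y)
      have : 0 ≤ Q.card * Real.log (openCount H Y) := by positivity
      push_cast
      linarith
    · have hpos' := openCount_pos (hne hq0.ne')
      have h1 := openCount_union H Y (R.pick Y)
      have h2 := openCount_le_card_mul R hQ Y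
      set u := openCount H Y
      set u' := openCount H (Y ∪ confirmedNonEdges H (R.pick Y))
      set g := (confirmedNonEdges H (R.pick Y) \ Y).ncard
      have hu : (0 : ℝ) < u := by exact_mod_cast hpos
      have hu' : (0 : ℝ) < u' := by exact_mod_cast hpos'
      have h1' : (u' : ℝ) + g = u := by exact_mod_cast h1
      have h2' : (u : ℝ) ≤ Q.card * g := by exact_mod_cast h2
      have hlog : Real.log u' - Real.log u ≤ u' / u - 1 := by
        rw [← Real.log_div hu'.ne' hu.ne']
        exact Real.log_le_sub_one_of_pos (by positivity)
      have hg : (u' : ℝ) / u - 1 = - (g / u) := by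
        field_simp
        linarith
      have h3 : 1 ≤ Q.card * ((g : ℝ) / u) := by
        rw [← mul_div_assoc, le_div_iff₀ hu]
        linarith
      have h4 : (Q.card : ℝ) * (Real.log u' - Real.log u) ≤ Q.card * (-(g / u)) :=
        mul_le_mul_of_nonneg_left (by linarith) (by positivity)
      push_cast
      nlinarith

/-! ### Query sets confirming all non-edges inside a vertex set -/

/-- The queries in `Q` confirm all non-edges of `H` with both endpoints in `U`. -/
def ConfirmsWithin {V : Type u} (H : SimpleGraph V) (U : Finset V) (Q : Finset (V × V)) : Prop :=
  ∀ a ∈ U, ∀ b ∈ U, a ≠ b → ¬ H.Adj a b → ∃ p ∈ Q, s(a, b) ∈ confirmedNonEdges H p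

open Classical in
/-- The vertices of `A` and their neighbours. -/
noncomputable def closedNbhd {V : Type u} [Fintype V] (H : SimpleGraph V) (A : Finset V) :
    Finset V :=
  A ∪ A.biUnion fun a => H.neighborFinset a

theorem mem_closedNbhd_self {V : Type u} [Fintype V] {H : SimpleGraph V} {A : Finset V} {a : V}
    (ha : a ∈ A) : a ∈ closedNbhd H A := by
  simp [closedNbhd, ha]

theorem mem_closedNbhd_of_adj {V : Type u} [Fintype V] {H : SimpleGraph V} {A : Finset V}
    {a b : V} (ha : a ∈ A) (hab : H.Adj a b) : b ∈ closedNbhd H A := by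
  simp only [closedNbhd, Finset.mem_union, Finset.mem_biUnion, SimpleGraph.mem_neighborFinset]
  exact Or.inr ⟨a, ha, hab⟩

theorem card_closedNbhd_le {V : Type u} [Fintype V] (H : SimpleGraph V) [DecidableRel H.Adj]
    (A : Finset V) : (closedNbhd H A).card ≤ A.card * (H.maxDegree + 1) := by
  classical
  have h : (A.biUnion fun a => H.neighborFinset a).card ≤ A.card * H.maxDegree := by
    refine Finset.card_biUnion_le_card_mul _ _ _ fun a _ => ?_
    rw [SimpleGraph.card_neighborFinset_eq_degree]
    convert H.degree_le_maxDegree a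
  have h' : closedNbhd H A = A ∪ A.biUnion fun a => H.neighborFinset a := by
    unfold closedNbhd
    congr!
  rw [h']
  refine (Finset.card_union_le _ _).trans ?_
  rw [mul_add, mul_one]
  omega

theorem SimpleGraph.Connected.exists_adj_dist_add_one {V : Type u} {H : SimpleGraph V}
    (hH : H.Connected) {a u : V} (h : a ≠ u) : ∃ x, H.Adj a x ∧ H.dist x u + 1 = H.dist a u := by
  obtain ⟨p, hp⟩ := hH.exists_walk_length_eq_dist a u
  cases p with
  | nil => exact absurd rfl h
  | @cons _ x _ hadj p =>
    refine ⟨x, hadj, ?_⟩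
    have h1 := SimpleGraph.dist_le p
    have h2 := hH.dist_triangle (u := a) (v := x) (w := u)
    rw [SimpleGraph.dist_eq_one_iff_adj.2 hadj] at h2
    rw [SimpleGraph.Walk.length_cons] at hp
    omega

/-- A vertex in `A` attaining the least distance from `A` to one of `u`, `v`. -/
theorem exists_nearest_pair {V : Type u} (H : SimpleGraph V) {A : Finset V} (hA : A.Nonempty)
    (u v : V) : ∃ a ∈ A, (∀ a' ∈ A, H.dist a u ≤ H.dist a' u ∧ H.dist a u ≤ H.dist a' v) ∨
      (∀ a' ∈ A, H.dist a v ≤ H.dist a' v ∧ H.dist a v ≤ H.dist a' u) := by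
  obtain ⟨a, ha, hmin⟩ := A.exists_min_image (fun a => min (H.dist a u) (H.dist a v)) hA
  refine ⟨a, ha, ?_⟩
  rcases le_total (H.dist a u) (H.dist a v) with h | h
  · left
    intro a' ha'
    have := hmin a' ha'
    simp only [min_eq_left h, le_min_iff] at this
    exact this
  · right
    intro a' ha'
    have := hmin a' ha'
    simp only [min_eq_right h, le_min_iff] at this
    exact this.symm

/-! ### Centers with small Voronoi cells -/

/-- The vertices of `U` strictly closer to `w` than to every vertex of `A`. -/
noncomputable def voronoiCell {V : Type u} (H : SimpleGraph V) (A U : Finset V) (w : V) : Finset V :=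
  U.filter fun v => ∀ a ∈ A, H.dist w v < H.dist a v

theorem voronoiCell_anti {V : Type u} (H : SimpleGraph V) {A A' : Finset V} (h : A ⊆ A')
    (U : Finset V) (w : V) : voronoiCell H A' U w ⊆ voronoiCell H A U w := by
  intro v hv
  rw [voronoiCell, Finset.mem_filter] at hv ⊢
  exact ⟨hv.1, fun a ha => hv.2 a (h ha)⟩

/-- The vertices whose cell has more than `|U| / s` elements. -/
noncomputable def largeCells {V : Type u} [Fintype V] (H : SimpleGraph V) (s : ℕ) (A U : Finset V) : Finset V :=
  Finset.univ.filter fun w => U.card < s * (voronoiCell H A U w).card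

/-- The total size of the large cells. -/
noncomputable def largeCellSum {V : Type u} [Fintype V] (H : SimpleGraph V) (s : ℕ) (A U : Finset V) : ℕ :=
  ∑ w ∈ largeCells H s A U, (voronoiCell H A U w).card

/-- By totality, every ordered pair or its reverse satisfies `f x ≤ f y`, so at least half of `B ×
B` is counted. -/
theorem card_sq_le_two_mul_card_le {ι : Type*} (B : Finset ι) (f : ι → ℕ) :
    B.card ^ 2 ≤ 2 * ∑ x ∈ B, (B.filter fun y => f x ≤ f y).card := by
  classical
  have h1 : ∑ x ∈ B, (B.filter fun y => f x ≤ f y).card =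
      ∑ x ∈ B, (B.filter fun y => f y ≤ f x).card := by
    simp only [Finset.card_filter]
    exact Finset.sum_comm
  rw [two_mul]
  nth_rw 2 [h1]
  rw [← Finset.sum_add_distrib, sq, ← smul_eq_mul, ← Finset.sum_const]
  refine Finset.sum_le_sum fun x _ => ?_
  refine le_trans (Finset.card_le_card ?_) (Finset.card_union_le _ _)
  intro y hy
  rw [← Finset.filter_or, Finset.mem_filter]
  exact ⟨hy, le_total _ _⟩

/-- Averaging over the set `W` of vertices with large cells. A new center `w₀` removes from the cell
of `w` each `v` that is at least as close to `w₀` as to `w`. If `B v` is the set of `w ∈ W` whose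
cell contains `v`, the drops sum to at least `½ ∑ |B v|²`, which is at least `S² / (2|U|)` by
Cauchy–Schwarz. Large cells give `|W| |U| ≤ s S`, so the average drop is at least `S / (2s)`. -/
theorem exists_center_largeCellSum_drop {V : Type u} [Fintype V] [DecidableEq V]
    (H : SimpleGraph V) (s : ℕ) (A U : Finset V) (hpos : 0 < largeCellSum H s A U) :
    ∃ w₀, largeCellSum H s A U ≤
      2 * s * (largeCellSum H s A U - largeCellSum H s (insert w₀ A) U) := by
  set W := largeCells H s A U with hW
  set S := largeCellSum H s A U with hS
  set B : V → Finset V := fun v => W.filter fun w => v ∈ voronoiCell H A U w with hB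
  set drop : V → ℕ := fun w₀ => ∑ w ∈ W, ((voronoiCell H A U w).filter fun v =>
    H.dist w₀ v ≤ H.dist w v).card with hdrop
  have hdrop_le : ∀ w₀, drop w₀ ≤ S - largeCellSum H s (insert w₀ A) U := by
    intro w₀
    have hWsub : largeCells H s (insert w₀ A) U ⊆ W := by
      intro w hw
      rw [hW]
      rw [largeCells, Finset.mem_filter] at hw ⊢
      exact ⟨hw.1, hw.2.trans_le (Nat.mul_le_mul_left _
        (Finset.card_le_card (voronoiCell_anti H (Finset.subset_insert _ _) U w)))⟩
    have h1 : largeCellSum H s (insert w₀ A) U ≤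
        ∑ w ∈ W, (voronoiCell H (insert w₀ A) U w).card :=
      Finset.sum_le_sum_of_subset hWsub
    have h2 : drop w₀ + ∑ w ∈ W, (voronoiCell H (insert w₀ A) U w).card = S := by
      rw [hdrop, hS, largeCellSum, ← Finset.sum_add_distrib]
      refine Finset.sum_congr rfl fun w _ => ?_
      rw [← Finset.card_filter_add_card_filter_not (s := voronoiCell H A U w)
        (p := fun v => H.dist w₀ v ≤ H.dist w v)]
      congr 2
      ext v
      simp only [voronoiCell, Finset.mem_filter, Finset.mem_insert, forall_eq_or_imp, not_le]
      tauto
    omega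
  have hSB : S = ∑ v ∈ U, (B v).card := by
    have : ∀ w, (voronoiCell H A U w).card = ∑ v ∈ U, if v ∈ voronoiCell H A U w then 1 else 0 := by
      intro w
      rw [← Finset.card_filter]
      congr 1
      ext v
      simp [voronoiCell]
    simp only [hS, largeCellSum, hB, Finset.card_filter, this]
    exact Finset.sum_comm
  have hsum : ∑ v ∈ U, ((B v).card) ^ 2 ≤ 2 * ∑ w₀ ∈ W, drop w₀ := by
    calc ∑ v ∈ U, ((B v).card) ^ 2
        ≤ ∑ v ∈ U, 2 * ∑ x ∈ B v, ((B v).filter fun y => H.dist x v ≤ H.dist y v).card :=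
          Finset.sum_le_sum fun v _ => card_sq_le_two_mul_card_le (B v) fun x => H.dist x v
      _ ≤ ∑ v ∈ U, 2 * ∑ x ∈ W, ((B v).filter fun y => H.dist x v ≤ H.dist y v).card := by
          gcongr with v hv
          exact Finset.filter_subset _ _
      _ = 2 * ∑ w₀ ∈ W, drop w₀ := by
          rw [← Finset.mul_sum, Finset.sum_comm]
          congr 1
          refine Finset.sum_congr rfl fun x _ => ?_
          simp only [hB, hdrop, Finset.filter_filter, voronoiCell, Finset.card_filter,
            Finset.mem_filter]
          rw [Finset.sum_comm]
          refine Finset.sum_congr rfl fun w _ => Finset.sum_congr rfl fun v hv => ?_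
          simp [hv]
  by_contra! hcon
  have hWne : W.Nonempty := by
    by_contra h
    rw [Finset.not_nonempty_iff_eq_empty] at h
    rw [hS, largeCellSum, ← hW, h] at hpos
    simp at hpos
  have h1 : ∑ w₀ ∈ W, 2 * s * drop w₀ < ∑ w₀ ∈ W, S :=
    Finset.sum_lt_sum_of_nonempty hWne fun w₀ _ =>
      (Nat.mul_le_mul_left _ (hdrop_le w₀)).trans_lt (hcon w₀)
  rw [← Finset.mul_sum, Finset.sum_const, smul_eq_mul] at h1
  have h2 : S ^ 2 ≤ U.card * ∑ v ∈ U, ((B v).card) ^ 2 := by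
    rw [hSB]
    exact sq_sum_le_card_mul_sum_sq
  have h3 : W.card * U.card ≤ s * S := by
    rw [hS, largeCellSum, Finset.mul_sum, ← smul_eq_mul, ← Finset.sum_const]
    refine Finset.sum_le_sum fun w hw => ?_
    rw [hW, largeCells, Finset.mem_filter] at hw
    exact hw.2.le
  have hU : 0 < U.card := by
    by_contra h
    have h0 : U.card = 0 := by omega
    rw [h0, zero_mul] at h2
    have := pow_pos hpos 2
    omega
  have h4 : s * S ^ 2 ≤ U.card * (2 * s * ∑ w₀ ∈ W, drop w₀) := by
    calc s * S ^ 2 ≤ s * (U.card * (2 * ∑ w₀ ∈ W, drop w₀)) := by gcongr; exact h2.trans (by gcongr)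
      _ = _ := by ring
  have h5 : U.card * (2 * s * ∑ w₀ ∈ W, drop w₀) < U.card * (W.card * S) :=
    Nat.mul_lt_mul_of_pos_left h1 hU
  have h6 : U.card * (W.card * S) ≤ s * S ^ 2 := by
    calc U.card * (W.card * S) = (W.card * U.card) * S := by ring
      _ ≤ s * S * S := by gcongr
      _ = _ := by ring
  omega

/-- A small set of centers all of whose cells have at most `|U| / s` elements. -/
theorem exists_centers {V : Type u} [Fintype V] [Nonempty V] (H : SimpleGraph V) {s : ℕ}
    (hs : 0 < s) (U : Finset V) :
    ∃ A : Finset V, (A.card : ℝ) ≤ 4 * s * Real.log (Fintype.card V) + 1 ∧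
      ∀ w, s * (voronoiCell H A U w).card ≤ U.card := by
  classical
  have hs' : (1 : ℝ) ≤ s := by exact_mod_cast hs
  set r : ℝ := 1 - 1 / (2 * s) with hr
  have hr0 : 0 ≤ r := by
    rw [hr, sub_nonneg, div_le_one (by positivity)]
    linarith
  have key : ∀ t : ℕ, ∃ A : Finset V, A.card ≤ t ∧
      (largeCellSum H s A U : ℝ) ≤ r ^ t * (Fintype.card V : ℝ) ^ 2 := by
    intro t
    induction t with
    | zero =>
      refine ⟨∅, by simp, ?_⟩
      have : largeCellSum H s ∅ U ≤ Fintype.card V * Fintype.card V := by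
        refine (Finset.sum_le_card_nsmul _ _ (Fintype.card V) fun w _ =>
          Finset.card_le_univ _).trans ?_
        rw [smul_eq_mul]
        gcongr
        exact Finset.card_le_univ _
      rw [pow_zero, one_mul, sq]
      exact_mod_cast this
    | succ t ih =>
      obtain ⟨A, hA, hS⟩ := ih
      rcases Nat.eq_zero_or_pos (largeCellSum H s A U) with h0 | hpos
      · refine ⟨A, by omega, ?_⟩
        rw [h0]
        push_cast
        positivity
      · obtain ⟨w₀, hw⟩ := exists_center_largeCellSum_drop H s A U hpos
        refine ⟨insert w₀ A, (Finset.card_insert_le _ _).trans (by omega), ?_⟩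
        -- Otherwise the truncated difference in `hw` would be 0, although the sum is positive.
        have hle : largeCellSum H s (insert w₀ A) U ≤ largeCellSum H s A U := by
          by_contra! h
          rw [Nat.sub_eq_zero_of_le h.le, mul_zero] at hw
          omega
        have hw' : (largeCellSum H s A U : ℝ) ≤
            2 * s * (largeCellSum H s A U - largeCellSum H s (insert w₀ A) U) := by
          rw [← Nat.cast_sub hle]
          exact_mod_cast hw
        have : (largeCellSum H s (insert w₀ A) U : ℝ) ≤ r * largeCellSum H s A U := by
          rw [hr, sub_mul, one_mul, div_mul_eq_mul_div, one_mul, le_sub_comm,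
            div_le_iff₀ (by positivity)]
          linarith
        calc (largeCellSum H s (insert w₀ A) U : ℝ) ≤ r * largeCellSum H s A U := this
          _ ≤ r * (r ^ t * (Fintype.card V : ℝ) ^ 2) := by gcongr
          _ = _ := by ring
  have hn : (0 : ℝ) < Fintype.card V := by exact_mod_cast Fintype.card_pos
  have hlog := Real.log_natCast_nonneg (Fintype.card V)
  -- Each center multiplies the sum, initially at most `n²`, by at most `1 - 1/(2s) ≤ exp(-1/(2s))`.
  -- More than `2s · 2 log n` centers push this integer below 1.
  obtain ⟨A, hA, hS⟩ := key (⌊4 * s * Real.log (Fintype.card V)⌋₊ + 1)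
  refine ⟨A, ?_, ?_⟩
  · calc (A.card : ℝ) ≤ ((⌊4 * s * Real.log (Fintype.card V)⌋₊ + 1 : ℕ) : ℝ) := by exact_mod_cast hA
      _ ≤ _ := by
        push_cast
        gcongr
        exact Nat.floor_le (by positivity)
  · have hlt : r ^ (⌊4 * s * Real.log (Fintype.card V)⌋₊ + 1) * (Fintype.card V : ℝ) ^ 2 < 1 := by
      set t := ⌊4 * s * Real.log (Fintype.card V)⌋₊ + 1 with ht
      have ht' : 4 * s * Real.log (Fintype.card V) < t := by
        rw [ht]
        push_cast
        exact Nat.lt_floor_add_one _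
      have h1 : r ≤ Real.exp (-(1 / (2 * s))) := Real.one_sub_le_exp_neg _
      calc r ^ t * (Fintype.card V : ℝ) ^ 2
          ≤ Real.exp (-(1 / (2 * s))) ^ t * Real.exp (Real.log (Fintype.card V)) ^ 2 := by
            rw [Real.exp_log hn]
            gcongr
        _ = Real.exp (t * (-(1 / (2 * s))) + 2 * Real.log (Fintype.card V)) := by
            rw [← Real.exp_nat_mul, ← Real.exp_nat_mul, ← Real.exp_add]
            norm_num
        _ < 1 := by
            rw [Real.exp_lt_one_iff]
            have : 2 * Real.log (Fintype.card V) < t * (1 / (2 * s)) := by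
              rw [mul_one_div, lt_div_iff₀ (by positivity)]
              linarith
            linarith
    have h0 : largeCellSum H s A U = 0 := by
      have : (largeCellSum H s A U : ℝ) < 1 := hS.trans_lt hlt
      exact_mod_cast Nat.lt_one_iff.1 (by exact_mod_cast this)
    intro w
    by_contra! hw
    have hmem : w ∈ largeCells H s A U := by
      rw [largeCells, Finset.mem_filter]
      exact ⟨Finset.mem_univ _, hw⟩
    have := (Finset.sum_eq_zero_iff.1 h0) w hmem
    rw [this] at hw
    omega

/-- A non-edge is confirmed by a query from near a center, or lies in a common cell. -/
theorem confirmed_or_mem_voronoiCell {V : Type u} [Fintype V] {H : SimpleGraph V}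
    (hH : H.Connected) {A : Finset V} {U : Finset V} {u v : V} (hu : u ∈ U) (hv : v ∈ U)
    (huv : u ≠ v) (hadj : ¬ H.Adj u v) {a : V} (ha : a ∈ A)
    (hmin : ∀ a' ∈ A, H.dist a u ≤ H.dist a' u ∧ H.dist a u ≤ H.dist a' v) :
    ∃ b ∈ closedNbhd H (closedNbhd H A), s(u, v) ∈ confirmedNonEdges H (b, v) ∨
      u ∈ voronoiCell H A U b ∧ v ∈ voronoiCell H A U b := by
  have ha' := mem_closedNbhd_self (H := H) ha
  by_cases hau : a = u
  · subst hau
    exact ⟨a, mem_closedNbhd_self ha', Or.inl (mem_confirmedNonEdges_self hH huv hadj)⟩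
  obtain ⟨x, hax, hx⟩ := hH.exists_adj_dist_add_one hau
  have hxN := mem_closedNbhd_of_adj ha hax
  by_cases hxu : x = u
  · subst hxu
    exact ⟨x, mem_closedNbhd_self hxN, Or.inl (mem_confirmedNonEdges_self hH huv hadj)⟩
  obtain ⟨b, hxb, hb⟩ := hH.exists_adj_dist_add_one hxu
  refine ⟨b, mem_closedNbhd_of_adj hxN hxb, ?_⟩
  -- If this fails, `dist b v ≤ dist b u + 1 = dist a u - 1`, strictly below the distance from any
  -- center to `v`. A single step from `a` would not give the strict inequality.
  by_cases hd : H.dist b u + 1 < H.dist b v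
  · exact Or.inl (mem_confirmedNonEdges_of_dist huv hadj hd)
  · right
    simp only [voronoiCell, Finset.mem_filter]
    refine ⟨⟨hu, fun a' h' => ?_⟩, hv, fun a' h' => ?_⟩
    · have := (hmin a' h').1
      omega
    · have := (hmin a' h').2
      omega

/-- Besides the queries `N × U`, the recursion enters the cell of each `b ∈ N`. There are at most `s
l (Δ + 1)²` of these, each of size at most `|U| / s`, so the total size grows by at most `l (Δ +
1)²` per level. The 2 in `hlP` absorbs `N × U`. -/
theorem exists_confirmsWithin_of_lt_pow {V : Type u} [Fintype V] {H : SimpleGraph V}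
    [DecidableRel H.Adj] (hH : H.Connected) {s : ℕ} (hs : 2 ≤ s) {l P : ℝ} (hP : 1 ≤ P)
    (hlP : 2 * l * (H.maxDegree + 1) ^ 2 ≤ P)
    (hcent : ∀ U : Finset V, ∃ A : Finset V, (A.card : ℝ) ≤ s * l ∧
      ∀ w, s * (voronoiCell H A U w).card ≤ U.card)
    (d : ℕ) (U : Finset V) (hU : U.card < s ^ d) :
    ∃ Q, ConfirmsWithin H U Q ∧ (Q.card : ℝ) ≤ s * P ^ d * U.card := by
  classical
  induction d generalizing U with
  | zero =>
    rw [pow_zero, Nat.lt_one_iff, Finset.card_eq_zero] at hU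
    subst hU
    exact ⟨∅, by simp [ConfirmsWithin], by simp⟩
  | succ d ih =>
    obtain ⟨A, hA, hcell⟩ := hcent U
    have hlt : ∀ w, (voronoiCell H A U w).card < s ^ d := fun w => by
      have := hcell w
      rw [pow_succ] at hU
      by_contra! h
      have := Nat.mul_le_mul_left s h
      rw [mul_comm] at hU
      omega
    choose Q hQ hQc using fun w => ih (voronoiCell H A U w) (hlt w)
    set N := closedNbhd H (closedNbhd H A) with hN
    have hNc : (N.card : ℝ) ≤ A.card * (H.maxDegree + 1) ^ 2 := by
      have h1 := card_closedNbhd_le H (closedNbhd H A)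
      have h2 := card_closedNbhd_le H A
      have : N.card ≤ A.card * (H.maxDegree + 1) ^ 2 := by
        calc N.card ≤ (A.card * (H.maxDegree + 1)) * (H.maxDegree + 1) :=
              h1.trans (Nat.mul_le_mul_right _ h2)
          _ = _ := by ring
      exact_mod_cast this
    refine ⟨N ×ˢ U ∪ N.biUnion Q, ?_, ?_⟩
    · intro u hu v hv huv hadj
      -- Without centers every cell is all of `U`, contradicting `s ≥ 2`.
      have hAne : A.Nonempty := by
        by_contra h
        rw [Finset.not_nonempty_iff_eq_empty] at h
        have h1 := hcell u
        have h2 : voronoiCell H A U u = U := by simp [voronoiCell, h]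
        rw [h2] at h1
        have := Finset.card_pos.2 ⟨u, hu⟩
        nlinarith
      obtain ⟨a, ha, hmin | hmin⟩ := exists_nearest_pair H hAne u v
      · obtain ⟨b, hb, h | ⟨h1, h2⟩⟩ := confirmed_or_mem_voronoiCell hH hu hv huv hadj ha hmin
        · exact ⟨(b, v), Finset.mem_union_left _ (Finset.mem_product.2 ⟨hb, hv⟩), h⟩
        · obtain ⟨p, hp, h⟩ := hQ b u h1 v h2 huv hadj
          exact ⟨p, Finset.mem_union_right _ (Finset.mem_biUnion.2 ⟨b, hb, hp⟩), h⟩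
      · have hadj' : ¬ H.Adj v u := fun h => hadj h.symm
        rw [Sym2.eq_swap]
        obtain ⟨b, hb, h | ⟨h1, h2⟩⟩ :=
          confirmed_or_mem_voronoiCell hH hv hu huv.symm hadj' ha hmin
        · exact ⟨(b, u), Finset.mem_union_left _ (Finset.mem_product.2 ⟨hb, hu⟩), h⟩
        · obtain ⟨p, hp, h⟩ := hQ b v h1 u h2 huv.symm hadj'
          exact ⟨p, Finset.mem_union_right _ (Finset.mem_biUnion.2 ⟨b, hb, hp⟩), h⟩
    · have hPd : 1 ≤ P ^ d := one_le_pow₀ hP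
      have h1 : ((N ×ˢ U ∪ N.biUnion Q).card : ℝ) ≤ N.card * U.card + ∑ b ∈ N, ((Q b).card : ℝ) := by
        have := (Finset.card_union_le (N ×ˢ U) (N.biUnion Q)).trans
          (Nat.add_le_add_left Finset.card_biUnion_le _)
        rw [Finset.card_product] at this
        exact_mod_cast this
      have h2 : ∑ b ∈ N, ((Q b).card : ℝ) ≤ N.card * (P ^ d * U.card) := by
        rw [← nsmul_eq_mul]
        refine Finset.sum_le_card_nsmul _ _ _ fun b _ => (hQc b).trans ?_
        have : (s : ℝ) * (voronoiCell H A U b).card ≤ U.card := by exact_mod_cast hcell b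
        calc (s : ℝ) * P ^ d * (voronoiCell H A U b).card
            = P ^ d * (s * (voronoiCell H A U b).card) := by ring
          _ ≤ _ := by gcongr
      calc ((N ×ˢ U ∪ N.biUnion Q).card : ℝ)
          ≤ N.card * U.card + N.card * (P ^ d * U.card) := by linarith
        _ ≤ N.card * (P ^ d * U.card) + N.card * (P ^ d * U.card) := by
            gcongr
            exact le_mul_of_one_le_left (by positivity) hPd
        _ = N.card * (2 * P ^ d * U.card) := by ring
        _ ≤ (s * l * (H.maxDegree + 1) ^ 2) * (2 * P ^ d * U.card) := by
            gcongr
            exact hNc.trans (by gcongr)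
        _ = s * (2 * l * (H.maxDegree + 1) ^ 2) * P ^ d * U.card := by ring
        _ ≤ s * P * P ^ d * U.card := by gcongr
        _ = _ := by ring

/-! ### Balanced separators from tree decompositions -/

/-- Both neighbours begin a shortest path from `t` to `i`, and paths in a tree are unique. -/
theorem SimpleGraph.IsTree.eq_of_dist_add_one {ι : Type*} {T : SimpleGraph ι} (hT : T.IsTree)
    {t x y i : ι} (hx : T.Adj t x) (hy : T.Adj t y) (hxi : T.dist x i + 1 = T.dist t i)
    (hyi : T.dist y i + 1 = T.dist t i) : x = y := by
  obtain ⟨p, hp⟩ := hT.connected.exists_walk_length_eq_dist x i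
  obtain ⟨q, hq⟩ := hT.connected.exists_walk_length_eq_dist y i
  have hp' : (SimpleGraph.Walk.cons hx p).IsPath :=
    SimpleGraph.Walk.isPath_of_length_eq_dist _ (by rw [SimpleGraph.Walk.length_cons]; omega)
  have hq' : (SimpleGraph.Walk.cons hy q).IsPath :=
    SimpleGraph.Walk.isPath_of_length_eq_dist _ (by rw [SimpleGraph.Walk.length_cons]; omega)
  have h := (hT.isAcyclic.subsingleton_path t i).elim ⟨_, hp'⟩ ⟨_, hq'⟩
  have h' := congrArg SimpleGraph.Walk.snd (Subtype.mk.inj h)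
  simpa using h'

/-- In a tree, the first steps from `t` towards two adjacent nodes other than `t` agree. -/
theorem SimpleGraph.IsTree.first_step_eq_of_adj {ι : Type*} {T : SimpleGraph ι} (hT : T.IsTree)
    {t x y i j : ι} (hij : T.Adj i j) (hx : T.Adj t x) (hy : T.Adj t y)
    (hxi : T.dist x i + 1 = T.dist t i) (hyj : T.dist y j + 1 = T.dist t j) : x = y := by
  wlog h : T.dist t j = T.dist t i + 1 generalizing i j x y
  · refine (this hij.symm hy hx hyj hxi ?_).symm
    rcases hT.dist_eq_dist_add_one_of_adj t hij with h' | h'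
    · exact h'
    · exact absurd h' h
  refine hT.eq_of_dist_add_one hx hy ?_ hyj
  have h1 := hT.connected.dist_triangle (u := x) (v := i) (w := j)
  have h2 := hT.connected.dist_triangle (u := t) (v := x) (w := j)
  rw [SimpleGraph.dist_eq_one_iff_adj.2 hij] at h1
  rw [SimpleGraph.dist_eq_one_iff_adj.2 hx] at h2
  omega

/-- Some bag of a tree decomposition splits the graph into parts each of which contains at most
half of `U`. -/
theorem TreeDecomposition.exists_balanced_bag {V : Type u} [DecidableEq V] {H : SimpleGraph V}
    (D : TreeDecomposition H) (U : Finset V) :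
    ∃ (t : Fin D.numNodes) (c : V → Fin D.numNodes),
      (∀ u v, H.Adj u v → u ∉ D.bag t → v ∉ D.bag t → c u = c v) ∧
      ∀ x, 2 * (U.filter fun v => v ∉ D.bag t ∧ c v = x).card ≤ U.card := by
  classical
  have hstep : ∀ t i, t ≠ i → ∃ x, D.tree.Adj t x ∧ D.tree.dist x i + 1 = D.tree.dist t i :=
    fun t i h => D.isTree.connected.exists_adj_dist_add_one h
  choose! f hf using hstep
  have hnode : ∀ v, ∃ i, v ∈ D.bag i := fun v => by
    obtain ⟨⟨i, hi⟩⟩ := (D.connected v).nonempty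
    exact ⟨i, hi⟩
  choose node hnode using hnode
  -- The nodes whose bags contain `v` form a connected set avoiding `t`, hence lie in one branch at
  -- `t`; `f t i` is the first step from `t` towards `i`.
  have hbranch : ∀ t v i j, v ∉ D.bag t → v ∈ D.bag i → v ∈ D.bag j → f t i = f t j := by
    intro t v i j ht hi hj
    have hne : ∀ k, v ∈ D.bag k → t ≠ k := by
      rintro k hk rfl
      exact ht hk
    obtain ⟨w⟩ := (D.connected v).preconnected ⟨i, hi⟩ ⟨j, hj⟩
    have key : ∀ (a b : {k | v ∈ D.bag k}), (D.tree.induce {k | v ∈ D.bag k}).Walk a b →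
        f t a = f t b := by
      intro a b w
      induction w with
      | nil => rfl
      | @cons a x b h _ ih =>
        rw [← ih]
        have ha := hf t a (hne a a.2)
        have hx := hf t x (hne x x.2)
        exact D.isTree.first_step_eq_of_adj h ha.1 hx.1 ha.2 hx.2
    exact key _ _ w
  have hadj : ∀ t u v, H.Adj u v → u ∉ D.bag t → v ∉ D.bag t → f t (node u) = f t (node v) := by
    intro t u v huv hu hv
    obtain ⟨i, hi, hi'⟩ := D.edge_mem u v huv
    exact (hbranch t u _ i hu (hnode u) hi).trans (hbranch t v i _ hv hi' (hnode v))
  -- Otherwise each node points to a neighbour whose branch holds more than half of `U`. A tree has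
  -- fewer edges than nodes, so two nodes point along the same edge in opposite directions. Their
  -- branches are disjoint, which is impossible.
  by_contra! hcon
  have hheavy : ∀ t, ∃ x, U.card < 2 * (U.filter fun v => v ∉ D.bag t ∧ f t (node v) = x).card :=
    fun t => hcon t (fun v => f t (node v)) (hadj t)
  choose g hg using hheavy
  have hmem : ∀ t v, v ∉ D.bag t → t ≠ node v := by
    rintro _ v h rfl
    exact h (hnode v)
  have hgadj : ∀ t, D.tree.Adj t (g t) := by
    intro t
    obtain ⟨v, hv⟩ := Finset.card_pos.1 (show 0 < (U.filter fun v => v ∉ D.bag t ∧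
      f t (node v) = g t).card by have := hg t; omega)
    rw [Finset.mem_filter] at hv
    rw [← hv.2.2]
    exact (hf t _ (hmem t v hv.2.1)).1
  have hcard : Fintype.card D.tree.edgeSet < Fintype.card (Fin D.numNodes) := by
    have := D.isTree.card_edgeFinset
    rw [SimpleGraph.edgeFinset_card] at this
    omega
  obtain ⟨t, t', hne, heq⟩ := Fintype.exists_ne_map_eq_of_card_lt
    (fun t => (⟨s(t, g t), hgadj t⟩ : D.tree.edgeSet)) hcard
  have heq' : s(t, g t) = s(t', g t') := congrArg Subtype.val heq
  rw [Sym2.eq_iff] at heq'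
  rcases heq' with ⟨h, -⟩ | ⟨h1, h2⟩
  · exact hne h
  · have hdisj : Disjoint (U.filter fun v => v ∉ D.bag t ∧ f t (node v) = g t)
        (U.filter fun v => v ∉ D.bag t' ∧ f t' (node v) = g t') := by
      rw [Finset.disjoint_left]
      intro v hv hv'
      rw [Finset.mem_filter] at hv hv'
      have e1 := (hf t _ (hmem t v hv.2.1)).2
      have e2 := (hf t' _ (hmem t' v hv'.2.1)).2
      rw [hv.2.2, h2] at e1
      rw [hv'.2.2, ← h1] at e2
      omega
    have h3 := Finset.card_union_of_disjoint hdisj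
    have h4 : ((U.filter fun v => v ∉ D.bag t ∧ f t (node v) = g t) ∪
        (U.filter fun v => v ∉ D.bag t' ∧ f t' (node v) = g t')).card ≤ U.card :=
      Finset.card_le_card (Finset.union_subset (Finset.filter_subset _ _)
        (Finset.filter_subset _ _))
    have := hg t
    have := hg t'
    omega

/-- A decomposition with a single bag. -/
theorem TreeDecomposition.nonempty {V : Type u} [Fintype V] (H : SimpleGraph V) :
    Nonempty (TreeDecomposition H) := by
  refine ⟨{ numNodes := 1, tree := ⊥, isTree := .of_subsingleton, bag := fun _ => Finset.univ,
            connected := fun v => ?_, edge_mem := fun a b _ => ⟨0, by simp⟩ }⟩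
  have : Nonempty {i : Fin 1 | v ∈ (Finset.univ : Finset V)} := ⟨⟨0, by simp⟩⟩
  have hsub : Subsingleton {i : Fin 1 | v ∈ (Finset.univ : Finset V)} := inferInstance
  exact ⟨fun a b => by rw [hsub.elim a b]⟩

theorem exists_treeDecomposition_card_le {V : Type u} [Fintype V] (H : SimpleGraph V) :
    ∃ D : TreeDecomposition H, ∀ i, (D.bag i).card ≤ treewidth H + 1 := by
  have := TreeDecomposition.nonempty H
  obtain ⟨D, hD⟩ := Nat.sInf_mem (Set.range_nonempty fun D : TreeDecomposition H => D.width)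
  refine ⟨D, fun i => ?_⟩
  have h1 : (D.bag i).card ≤ Finset.univ.sup fun i => (D.bag i).card :=
    Finset.le_sup (f := fun i => (D.bag i).card) (Finset.mem_univ i)
  have h2 : D.width = treewidth H := hD
  rw [TreeDecomposition.width] at h2
  omega

/-- The bag containing both ends of an edge has two elements. This lets `tw + 1` be absorbed into `2
tw`. -/
theorem one_le_treewidth {V : Type u} [Fintype V] {H : SimpleGraph V} {a b : V}
    (hab : H.Adj a b) : 1 ≤ treewidth H := by
  classical
  obtain ⟨D, hD⟩ := exists_treeDecomposition_card_le H
  obtain ⟨i, ha, hb⟩ := D.edge_mem a b hab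
  have h1 := hD i
  have h2 := Finset.card_le_card (show {a, b} ⊆ D.bag i by
    intro x hx
    rw [Finset.mem_insert, Finset.mem_singleton] at hx
    rcases hx with rfl | rfl <;> assumption)
  rw [Finset.card_pair hab.ne] at h2
  omega

/-! ### Query sets from separators -/

/-- If `c` is constant along edges outside `S`, shortest paths between different colours
meet `S`. -/
theorem exists_mem_separator_dist_add_le {V : Type u} {ι : Type*} {H : SimpleGraph V}
    (hH : H.Connected) {S : Finset V} {c : V → ι}
    (hc : ∀ u v, H.Adj u v → u ∉ S → v ∉ S → c u = c v) {u v : V} (hu : u ∉ S)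
    (huv : c u ≠ c v) : ∃ x ∈ S, H.dist u x + H.dist x v ≤ H.dist u v := by
  classical
  have key : ∀ (u v : V) (p : H.Walk u v), u ∉ S → c u ≠ c v → ∃ x ∈ S, x ∈ p.support := by
    intro u v p
    induction p with
    | nil => exact fun _ h => absurd rfl h
    | @cons u x v h p ih =>
      intro hu huv
      by_cases hx : x ∈ S
      · exact ⟨x, hx, by simp⟩
      · obtain ⟨y, hy, hyp⟩ := ih hx (by rwa [← hc u x h hu hx])
        exact ⟨y, hy, by simp [hyp]⟩
  obtain ⟨p, hp⟩ := hH.exists_walk_length_eq_dist u v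
  obtain ⟨x, hx, hxp⟩ := key u v p hu huv
  refine ⟨x, hx, ?_⟩
  have h1 := congrArg SimpleGraph.Walk.length (p.take_spec hxp)
  rw [SimpleGraph.Walk.length_append] at h1
  have h2 := SimpleGraph.dist_le (p.takeUntil x hxp)
  have h3 := SimpleGraph.dist_le (p.dropUntil x hxp)
  omega

/-- Queries from a neighbour of the separator confirm the non-edges across it. -/
theorem confirmed_of_separated {V : Type u} {ι : Type*} [Fintype V] {H : SimpleGraph V}
    (hH : H.Connected) {S : Finset V} {c : V → ι}
    (hc : ∀ u v, H.Adj u v → u ∉ S → v ∉ S → c u = c v) {u v : V} (hu : u ∉ S)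
    (huv : c u ≠ c v) (hadj : ¬ H.Adj u v) {a : V} (ha : a ∈ S)
    (hmin : ∀ a' ∈ S, H.dist a u ≤ H.dist a' u ∧ H.dist a u ≤ H.dist a' v) :
    ∃ b ∈ closedNbhd H S, s(u, v) ∈ confirmedNonEdges H (b, v) := by
  have hne : u ≠ v := fun h => huv (congrArg c h)
  have hau : a ≠ u := by
    rintro rfl
    exact hu ha
  obtain ⟨x, hax, hx⟩ := hH.exists_adj_dist_add_one hau
  have hxS : x ∉ S := fun h => by
    have := (hmin x h).1
    omega
  -- Otherwise a shortest path from `x` to `u` meets `S` in a vertex closer to `u` than `a`. Hence a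
  -- shortest path from `x` to `v` crosses `S`, at some `y`, and `dist x v ≥ 1 + dist y v ≥ 1 + dist
  -- a u = dist x u + 2`.
  have hxu : c x = c u := by
    by_contra h
    obtain ⟨y, hy, hle⟩ := exists_mem_separator_dist_add_le hH hc hxS h
    have := (hmin y hy).1
    omega
  obtain ⟨y, hy, hle⟩ := exists_mem_separator_dist_add_le hH hc hxS (v := v) (by rwa [hxu])
  have h1 := (hmin y hy).2
  have h2 : 0 < H.dist x y := hH.pos_dist_of_ne (by rintro rfl; exact hxS hy)
  exact ⟨x, mem_closedNbhd_of_adj ha hax, mem_confirmedNonEdges_of_dist hne hadj (by omega)⟩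

/-- One decomposition of `H` serves all levels: only `U` shrinks, and distances stay those of `H`.
The parts are disjoint, so each level costs at most `(tw + 1)(Δ + 1)|U|`. -/
theorem exists_confirmsWithin_of_treewidth {V : Type u} [Fintype V] {H : SimpleGraph V}
    [DecidableRel H.Adj] (hH : H.Connected) (d : ℕ) (U : Finset V) (hU : U.card < 2 ^ d) :
    ∃ Q, ConfirmsWithin H U Q ∧
      Q.card ≤ (treewidth H + 1) * (H.maxDegree + 1) * U.card * d := by
  classical
  obtain ⟨D, hD⟩ := exists_treeDecomposition_card_le H
  induction d generalizing U with
  | zero =>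
    rw [pow_zero, Nat.lt_one_iff, Finset.card_eq_zero] at hU
    subst hU
    exact ⟨∅, by simp [ConfirmsWithin], by simp⟩
  | succ d ih =>
    obtain ⟨t, c, hc, hhalf⟩ := D.exists_balanced_bag U
    choose Q hQ hQc using fun x => ih (U.filter fun v => v ∉ D.bag t ∧ c v = x) (by
      have := hhalf x
      rw [pow_succ] at hU
      omega)
    refine ⟨closedNbhd H (D.bag t) ×ˢ U ∪ Finset.univ.biUnion Q, ?_, ?_⟩
    · intro u hu v hv huv hadj
      have hadj' : ¬ H.Adj v u := fun h => hadj h.symm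
      by_cases huS : u ∈ D.bag t
      · exact ⟨(u, v), Finset.mem_union_left _ (Finset.mem_product.2
          ⟨mem_closedNbhd_self huS, hv⟩), mem_confirmedNonEdges_self hH huv hadj⟩
      by_cases hvS : v ∈ D.bag t
      · refine ⟨(v, u), Finset.mem_union_left _ (Finset.mem_product.2
          ⟨mem_closedNbhd_self hvS, hu⟩), ?_⟩
        rw [Sym2.eq_swap]
        exact mem_confirmedNonEdges_self hH huv.symm hadj'
      by_cases hcuv : c u = c v
      · obtain ⟨p, hp, h⟩ := hQ (c v) u (Finset.mem_filter.2 ⟨hu, huS, hcuv⟩) v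
          (Finset.mem_filter.2 ⟨hv, hvS, rfl⟩) huv hadj
        exact ⟨p, Finset.mem_union_right _ (Finset.mem_biUnion.2 ⟨_, Finset.mem_univ _, hp⟩), h⟩
      · obtain ⟨y, hy, -⟩ := exists_mem_separator_dist_add_le hH hc huS hcuv
        obtain ⟨a, ha, hmin | hmin⟩ := exists_nearest_pair H ⟨y, hy⟩ u v
        · obtain ⟨b, hb, h⟩ := confirmed_of_separated hH hc huS hcuv hadj ha hmin
          exact ⟨(b, v), Finset.mem_union_left _ (Finset.mem_product.2 ⟨hb, hv⟩), h⟩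
        · obtain ⟨b, hb, h⟩ := confirmed_of_separated hH hc hvS (Ne.symm hcuv) hadj' ha hmin
          rw [Sym2.eq_swap]
          exact ⟨(b, u), Finset.mem_union_left _ (Finset.mem_product.2 ⟨hb, hu⟩), h⟩
    · set K := (treewidth H + 1) * (H.maxDegree + 1) with hK
      have h1 : (closedNbhd H (D.bag t)).card ≤ K :=
        (card_closedNbhd_le H _).trans (Nat.mul_le_mul_right _ (hD t))
      have h2 : ∑ x, (U.filter fun v => v ∉ D.bag t ∧ c v = x).card ≤ U.card := by
        rw [Finset.card_eq_sum_card_fiberwise (f := c) (t := Finset.univ) (fun _ _ => by simp)]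
        refine Finset.sum_le_sum fun x _ => Finset.card_le_card ?_
        intro v hv
        rw [Finset.mem_filter] at hv ⊢
        exact ⟨hv.1, hv.2.2⟩
      calc (closedNbhd H (D.bag t) ×ˢ U ∪ Finset.univ.biUnion Q).card
          ≤ (closedNbhd H (D.bag t)).card * U.card + ∑ x, (Q x).card := by
            rw [← Finset.card_product]
            exact (Finset.card_union_le _ _).trans
              (Nat.add_le_add_left Finset.card_biUnion_le _)
        _ ≤ K * U.card + ∑ x, K * (U.filter fun v => v ∉ D.bag t ∧ c v = x).card * d := by
            gcongr with x
            exact hQc x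
        _ = K * U.card + K * (∑ x, (U.filter fun v => v ∉ D.bag t ∧ c v = x).card) * d := by
            rw [← Finset.sum_mul, ← Finset.mul_sum]
        _ ≤ K * U.card + K * U.card * d := by gcongr
        _ = _ := by ring

/-! ### Bounds on the number of queries -/

theorem GreedyRule.length_edgeOrder {V : Type u} {H : SimpleGraph V} (R : GreedyRule H) :
    R.edgeOrder.length = H.edgeSet.ncard := by
  classical
  have h : H.edgeSet = ((R.edgeOrder.map fun p => s(p.1, p.2)).toFinset : Set (Sym2 V)) := by
    ext e
    rw [List.coe_toFinset, Set.mem_ofPred_eq, R.mem_iff]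
  rw [h, Set.ncard_coe_finset, List.toFinset_card_of_nodup R.nodup, List.length_map]

theorem GreedyRule.length_edgeOrder_le {V : Type u} [Fintype V] {H : SimpleGraph V}
    [DecidableRel H.Adj] (R : GreedyRule H) :
    R.edgeOrder.length ≤ Fintype.card V * H.maxDegree := by
  have h1 := H.sum_degrees_eq_twice_card_edges
  have h2 : ∑ v, H.degree v ≤ Fintype.card V * H.maxDegree := by
    refine (Finset.sum_le_card_nsmul _ _ _ fun v _ => H.degree_le_maxDegree v).trans ?_
    simp
  have h3 : R.edgeOrder.length = H.edgeFinset.card := by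
    rw [R.length_edgeOrder, ← Set.ncard_coe_finset, SimpleGraph.coe_edgeFinset]
  omega

theorem length_edgeOrder_add_openCount_le {V : Type u} [Fintype V] {H : SimpleGraph V}
    (R : GreedyRule H) : R.edgeOrder.length + openCount H ∅ ≤ (Fintype.card V).choose 2 := by
  classical
  rw [R.length_edgeOrder, openCount, Set.sdiff_empty,
    ← SimpleGraph.card_edgeFinset_top_eq_card_choose_two (V := V), ← Set.ncard_coe_finset,
    SimpleGraph.coe_edgeFinset, ← Set.ncard_union_eq ?_ (Set.toFinite _) (Set.toFinite _)]
  · exact Set.ncard_le_ncard (Set.union_subset (SimpleGraph.edgeSet_mono le_top)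
      (SimpleGraph.edgeSet_mono le_top)) (Set.toFinite _)
  · rw [SimpleGraph.disjoint_edgeSet]
    exact disjoint_compl_right

theorem queries_le_choose_two {V : Type u} [Fintype V] {H : SimpleGraph V} (hH : H.Connected)
    (R : GreedyRule H) {oracle : V → V → ℕ} {q : ℕ} {ans : Bool}
    (h : (greedyVerify R).Returns oracle q ans) : q ≤ (Fintype.card V).choose 2 :=
  (queries_le_trivial hH R h).trans (length_edgeOrder_add_openCount_le R)

theorem queries_le_sq {V : Type u} [Fintype V] {H : SimpleGraph V} (hH : H.Connected)
    (R : GreedyRule H) {oracle : V → V → ℕ} {q : ℕ} {ans : Bool}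
    (h : (greedyVerify R).Returns oracle q ans) : q ≤ Fintype.card V ^ 2 :=
  (queries_le_choose_two hH R h).trans (Nat.choose_le_pow _ _)

theorem queries_le_of_confirmsWithin_univ {V : Type u} [Fintype V] [Nonempty V]
    {H : SimpleGraph V} [DecidableRel H.Adj] (R : GreedyRule H) {oracle : V → V → ℕ} {q : ℕ}
    {ans : Bool} (h : (greedyVerify R).Returns oracle q ans) {Q : Finset (V × V)}
    (hQ : ConfirmsWithin H Finset.univ Q) :
    (q : ℝ) ≤ Fintype.card V * H.maxDegree + 1 +
      2 * Q.card * Real.log (Fintype.card V) := by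
  have h1 := queries_le_of_cover R h (Q := Q) fun a b =>
    hQ a (Finset.mem_univ _) b (Finset.mem_univ _)
  have h2 : (R.edgeOrder.length : ℝ) ≤ Fintype.card V * H.maxDegree := by
    exact_mod_cast R.length_edgeOrder_le
  have h3 : Real.log (openCount H ∅) ≤ 2 * Real.log (Fintype.card V) := by
    rcases Nat.eq_zero_or_pos (openCount H ∅) with h0 | h0
    · rw [h0, Nat.cast_zero, Real.log_zero]
      have := Real.log_natCast_nonneg (Fintype.card V)
      positivity
    · have : openCount H ∅ ≤ Fintype.card V ^ 2 :=
        (Nat.le_add_left _ _).trans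
          ((length_edgeOrder_add_openCount_le R).trans (Nat.choose_le_pow _ _))
      calc Real.log (openCount H ∅) ≤ Real.log ((Fintype.card V : ℝ) ^ 2) :=
            Real.log_le_log (by exact_mod_cast h0) (by exact_mod_cast this)
        _ = _ := by rw [Real.log_pow]; norm_num
  have h4 : (Q.card : ℝ) * Real.log (openCount H ∅) ≤
      Q.card * (2 * Real.log (Fintype.card V)) := by gcongr
  linarith

theorem SimpleGraph.Connected.exists_adj_of_two_le_card {V : Type u} [Fintype V]
    {H : SimpleGraph V} (hH : H.Connected) (h : 2 ≤ Fintype.card V) : ∃ a b, H.Adj a b := by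
  obtain ⟨a, b, hab⟩ := Fintype.exists_pair_of_one_lt_card (α := V) (by omega)
  obtain ⟨x, hx, -⟩ := hH.exists_adj_dist_add_one hab
  exact ⟨a, x, hx⟩

theorem SimpleGraph.Connected.one_le_maxDegree {V : Type u} [Fintype V]
    {H : SimpleGraph V} [DecidableRel H.Adj] (hH : H.Connected) (h : 2 ≤ Fintype.card V) :
    1 ≤ H.maxDegree := by
  obtain ⟨a, b, hab⟩ := hH.exists_adj_of_two_le_card h
  exact ((H.degree_pos_iff_exists_adj a).2 ⟨b, hab⟩).trans_le (H.degree_le_maxDegree a)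

theorem queries_le_treewidth {V : Type u} [Fintype V] {H : SimpleGraph V} [DecidableRel H.Adj]
    (hH : H.Connected) (R : GreedyRule H) {oracle : V → V → ℕ} {q : ℕ} {ans : Bool}
    (h : (greedyVerify R).Returns oracle q ans) :
    (q : ℝ) ≤ 36 * ((H.maxDegree : ℝ) *
      ((H.maxDegree : ℝ) + (treewidth H : ℝ) * Real.log (Fintype.card V)) *
      (Fintype.card V : ℝ) * Real.log (Fintype.card V) ^ 2) := by
  have := hH.nonempty
  have hn := Fintype.card_pos (α := V)
  rcases Nat.lt_or_ge (Fintype.card V) 2 with hlt | hge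
  · have h1 : Fintype.card V = 1 := by omega
    have h2 := queries_le_choose_two hH R h
    rw [h1] at h2
    have h3 : q = 0 := by simpa using h2
    rw [h3, h1]
    simp
  have hΔ : (1 : ℝ) ≤ H.maxDegree := by exact_mod_cast hH.one_le_maxDegree hge
  obtain ⟨a, b, hab⟩ := hH.exists_adj_of_two_le_card hge
  have hw : (1 : ℝ) ≤ treewidth H := by exact_mod_cast one_le_treewidth hab
  have hn2 : (2 : ℝ) ≤ Fintype.card V := by exact_mod_cast hge
  obtain ⟨Q, hQ, hQc⟩ := exists_confirmsWithin_of_treewidth hH (Nat.log 2 (Fintype.card V) + 1)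
    Finset.univ (by rw [Finset.card_univ]; exact Nat.lt_pow_succ_log_self (by norm_num) _)
  have hq := queries_le_of_confirmsWithin_univ R h hQ
  rw [Finset.card_univ] at hQc
  have hl2 := Real.log_two_gt_d9
  have hlog : Real.log 2 ≤ Real.log (Fintype.card V) := Real.log_le_log (by norm_num) hn2
  -- Both `⌊log₂ n⌋` and 1 are at most `log n / log 2`, and `2 / log 2 < 3`.
  have hd : ((Nat.log 2 (Fintype.card V) + 1 : ℕ) : ℝ) ≤ 3 * Real.log (Fintype.card V) := by
    have h1 : (Nat.log 2 (Fintype.card V) : ℝ) * Real.log 2 ≤ Real.log (Fintype.card V) := by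
      rw [← Real.log_pow]
      refine Real.log_le_log (by positivity) ?_
      exact_mod_cast Nat.pow_log_le_self 2 hn.ne'
    push_cast
    nlinarith
  have hQc' : (Q.card : ℝ) ≤ (treewidth H + 1) * (H.maxDegree + 1) * Fintype.card V *
      ((Nat.log 2 (Fintype.card V) + 1 : ℕ) : ℝ) := by exact_mod_cast hQc
  generalize ((Nat.log 2 (Fintype.card V) + 1 : ℕ) : ℝ) = d at hd hQc'
  generalize Real.log (Fintype.card V) = L at *
  generalize (Fintype.card V : ℝ) = n at *
  generalize (H.maxDegree : ℝ) = Δ at *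
  generalize (treewidth H : ℝ) = w at *
  generalize (Q.card : ℝ) = k at *
  have hL : 0.69 ≤ L := by linarith
  have hL' : 0 ≤ 3 * L := by linarith
  have hk : k ≤ (w + w) * (Δ + Δ) * n * (3 * L) := by
    calc k ≤ (w + 1) * (Δ + 1) * n * d := hQc'
      _ ≤ (w + 1) * (Δ + 1) * n * (3 * L) := by gcongr
      _ ≤ _ := by gcongr
  -- The construction gives one factor `L` less than the claim; `24 ≤ 36 L` holds as `L ≥ 0.69`.
  have h1 : 2 * k * L ≤ 36 * (Δ * (w * L) * n * L ^ 2) := by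
    calc 2 * k * L ≤ 2 * ((w + w) * (Δ + Δ) * n * (3 * L)) * L := by gcongr
      _ = 24 * (Δ * w * n * L ^ 2) := by ring
      _ ≤ (36 * L) * (Δ * w * n * L ^ 2) := by gcongr; linarith
      _ = _ := by ring
  have h2 : n * Δ + 1 ≤ 36 * (Δ * Δ * n * L ^ 2) := by
    have h3 : 1 ≤ n * Δ := by nlinarith
    have h4 : n * Δ ≤ n * Δ * Δ := le_mul_of_one_le_right (by linarith) hΔ
    have h5 : 2 ≤ 36 * L ^ 2 := by nlinarith
    calc n * Δ + 1 ≤ 2 * (n * Δ * Δ) := by linarith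
      _ ≤ (36 * L ^ 2) * (n * Δ * Δ) := by gcongr
      _ = _ := by ring
  calc (q : ℝ) ≤ n * Δ + 1 + 2 * k * L := hq
    _ ≤ 36 * (Δ * Δ * n * L ^ 2) + 36 * (Δ * (w * L) * n * L ^ 2) := by linarith
    _ = _ := by ring

/-! ### The bound in terms of the maximum degree -/

/-- From `2³ ≤ 3²`. A bound above 1 keeps `log log n` away from 0, so that constants can be absorbed
into it. -/
theorem log_gt_of_three_le {n : ℝ} (hn : 3 ≤ n) : 1.039 < Real.log n := by
  have h1 : Real.log 3 ≤ Real.log n := Real.log_le_log (by norm_num) hn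
  have h2 : 3 * Real.log 2 ≤ 2 * Real.log 3 := by
    have : Real.log ((2 : ℝ) ^ 3) ≤ Real.log ((3 : ℝ) ^ 2) :=
      Real.log_le_log (by norm_num) (by norm_num)
    rw [Real.log_pow, Real.log_pow] at this
    exact_mod_cast this
  have := Real.log_two_gt_d9
  linarith

/-- Choice of the branching factor and the depth of the recursion through Voronoi cells. -/
theorem exists_branching_and_depth {n Δ : ℝ} (hn : 3 ≤ n) (hΔ : 1 ≤ Δ) (hΔn : Δ ≤ n) :
    ∃ s d : ℕ, 2 ≤ s ∧ n < (s : ℝ) ^ d ∧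
      n * s * (40 * Δ ^ 2 * Real.log n) ^ (d + 1) ≤
        n ^ (1 + 144 * √((Real.log (Real.log n) + Real.log Δ) / Real.log n)) := by
  have hL := log_gt_of_three_le hn
  set L := Real.log n with hLdef
  have hL0 : 0 < L := by linarith
  have hn0 : 0 < n := by linarith
  set P := 40 * Δ ^ 2 * L with hP
  have hP0 : 0 < P := by positivity
  set p := Real.log P with hp
  have hlogΔ : 0 ≤ Real.log Δ := Real.log_nonneg hΔ
  have hlogΔL : Real.log Δ ≤ L := Real.log_le_log (by linarith) hΔn
  have hlogL : Real.log L ≤ L - 1 := Real.log_le_sub_one_of_pos hL0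
  have hlogL' : 1 / 30 ≤ Real.log L := by
    have h1 := Real.one_sub_inv_le_log_of_pos hL0
    have h2 : L⁻¹ ≤ 29 / 30 := by
      rw [inv_le_comm₀ hL0 (by norm_num)]
      norm_num
      linarith
    linarith
  have hp_eq : p = Real.log 40 + 2 * Real.log Δ + Real.log L := by
    rw [hp, hP, Real.log_mul (by positivity) (by positivity),
      Real.log_mul (by positivity) (by positivity), Real.log_pow]
    norm_num
  have h40 : Real.log 40 ≤ 5 := by
    have h1 : Real.log 40 ≤ Real.log ((2 : ℝ) ^ 6) := Real.log_le_log (by norm_num) (by norm_num)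
    rw [Real.log_pow] at h1
    have := Real.log_two_lt_d9
    push_cast at h1
    linarith
  have h40' : 1 ≤ Real.log 40 := by
    have h1 : Real.log ((2 : ℝ) ^ 5) ≤ Real.log 40 := Real.log_le_log (by norm_num) (by norm_num)
    rw [Real.log_pow] at h1
    have := Real.log_two_gt_d9
    push_cast at h1
    linarith
  have hp1 : 1 ≤ p := by rw [hp_eq]; linarith
  -- This balances the branching factor `n ^ x` against `P ^ (1 / x)`: as `x² L = p`, both equal
  -- `exp (x L)`.
  set x := √(p / L) with hx
  have hx0 : 0 < x := Real.sqrt_pos.2 (by positivity)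
  have hxx : x ^ 2 * L = p := by
    rw [hx, Real.sq_sqrt (by positivity)]
    field_simp
  have hxL : 1 ≤ x * L := by
    have : (1 : ℝ) ^ 2 ≤ (x * L) ^ 2 := by
      have : (x * L) ^ 2 = p * L := by rw [← hxx]; ring
      nlinarith
    exact le_of_sq_le_sq this (by positivity)
  have hx3 : x ≤ 3 := by
    rw [hx, Real.sqrt_le_left (by norm_num), div_le_iff₀ hL0, hp_eq]
    linarith
  -- Since `log 40 ≤ 5 ≤ 150 log L`, `p` is at most `16² (log L + log Δ)`.
  have hxy : x ≤ 16 * √((Real.log L + Real.log Δ) / L) := by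
    have h16 : (16 : ℝ) = √(16 ^ 2) := (Real.sqrt_sq (by norm_num)).symm
    rw [hx, h16, ← Real.sqrt_mul (by positivity)]
    refine Real.sqrt_le_sqrt ?_
    rw [← mul_div_assoc]
    gcongr
    rw [hp_eq]
    linarith
  have hnx : n ^ x = Real.exp (x * L) := by
    rw [Real.rpow_def_of_pos hn0, mul_comm]
  have hnx1 : 1 < n ^ x := Real.one_lt_rpow (by linarith) hx0
  refine ⟨⌈n ^ x⌉₊, ⌊1 / x⌋₊ + 1, ?_, ?_, ?_⟩
  · exact Nat.lt_ceil.2 (by exact_mod_cast hnx1)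
  · have h1 : 1 / x < ((⌊1 / x⌋₊ + 1 : ℕ) : ℝ) := by
      push_cast
      exact Nat.lt_floor_add_one _
    have h2 : 1 < x * ((⌊1 / x⌋₊ + 1 : ℕ) : ℝ) := by
      rwa [div_lt_iff₀' hx0] at h1
    calc n = n ^ (1 : ℝ) := (Real.rpow_one n).symm
      _ < n ^ (x * ((⌊1 / x⌋₊ + 1 : ℕ) : ℝ)) := Real.rpow_lt_rpow_of_exponent_lt (by linarith) h2
      _ = (n ^ x) ^ (⌊1 / x⌋₊ + 1) := by rw [Real.rpow_mul hn0.le, Real.rpow_natCast]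
      _ ≤ _ := by
        gcongr
        exact Nat.le_ceil _
  · set d := ⌊1 / x⌋₊ + 1 with hd
    have hs : (⌈n ^ x⌉₊ : ℝ) ≤ Real.exp (x * L + x * L) := by
      have h1 := Nat.ceil_lt_add_one (a := n ^ x) (by positivity)
      have h2 : 2 ≤ Real.exp (x * L) := by
        have := Real.add_one_le_exp (x * L)
        linarith
      rw [Real.exp_add]
      rw [hnx] at h1 ⊢
      nlinarith
    have hdx : ((d + 1 : ℕ) : ℝ) ≤ 1 / x + 2 := by
      have := Nat.floor_le (a := 1 / x) (by positivity)
      rw [hd]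
      push_cast
      linarith
    have hPd : P ^ (d + 1) ≤ Real.exp (7 * (x * L)) := by
      rw [← Real.exp_log hP0, ← Real.exp_nat_mul, Real.exp_le_exp, ← hp]
      calc ((d + 1 : ℕ) : ℝ) * p ≤ (1 / x + 2) * p := by gcongr
        _ = x * L + 2 * x * (x * L) := by
          rw [← hxx]
          field_simp
        _ ≤ x * L + 2 * 3 * (x * L) := by gcongr
        _ = _ := by ring
    -- Rounding up costs a second `x L`, and `d + 1 ≤ 1/x + 2` with `x ≤ 3` gives `7 x L`. The
    -- exponent is `1 + 9x`, and `9 · 16 = 144`.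
    calc n * ⌈n ^ x⌉₊ * P ^ (d + 1)
        ≤ Real.exp L * Real.exp (x * L + x * L) * Real.exp (7 * (x * L)) := by
          rw [hLdef, Real.exp_log hn0]
          gcongr
      _ = Real.exp (L * (1 + 9 * x)) := by
          rw [← Real.exp_add, ← Real.exp_add]
          congr 1
          ring
      _ ≤ Real.exp (L * (1 + 144 * √((Real.log L + Real.log Δ) / L))) := by
          refine Real.exp_le_exp.2 (mul_le_mul_of_nonneg_left ?_ hL0.le)
          linarith
      _ = _ := by rw [Real.rpow_def_of_pos hn0]

theorem queries_le_maxDegree {V : Type u} [Fintype V] {H : SimpleGraph V} [DecidableRel H.Adj]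
    (hH : H.Connected) (hn : 3 ≤ Fintype.card V) (R : GreedyRule H) {oracle : V → V → ℕ} {q : ℕ}
    {ans : Bool} (h : (greedyVerify R).Returns oracle q ans) :
    (q : ℝ) ≤ (Fintype.card V : ℝ) ^ (1 + 144 *
      √((Real.log (Real.log (Fintype.card V)) + Real.log H.maxDegree) /
        Real.log (Fintype.card V))) := by
  have := hH.nonempty
  have hn3 : (3 : ℝ) ≤ Fintype.card V := by exact_mod_cast hn
  have hΔ : (1 : ℝ) ≤ H.maxDegree := by exact_mod_cast hH.one_le_maxDegree (by omega)
  have hΔn : (H.maxDegree : ℝ) ≤ Fintype.card V := by exact_mod_cast H.maxDegree_lt_card_verts.le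
  obtain ⟨s, d, hs, hsd, hbound⟩ := exists_branching_and_depth hn3 hΔ hΔn
  refine le_trans ?_ hbound
  have hL := log_gt_of_three_le hn3
  have hs2 : (2 : ℝ) ≤ s := by exact_mod_cast hs
  have hΔ2 : (H.maxDegree : ℝ) ≤ (H.maxDegree : ℝ) ^ 2 := by nlinarith
  have hP1 : 1 ≤ 40 * (H.maxDegree : ℝ) ^ 2 * Real.log (Fintype.card V) := by nlinarith
  -- `4 s log n + 1 ≤ s · 5 log n` explains `l`; then `2 · 5 · (2Δ)² log n` is `P`.
  obtain ⟨Q, hQ, hQc⟩ := exists_confirmsWithin_of_lt_pow hH hs (l := 5 * Real.log (Fintype.card V))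
    hP1 (by
      have : ((H.maxDegree : ℝ) + 1) ^ 2 ≤ (H.maxDegree + H.maxDegree : ℝ) ^ 2 := by gcongr
      nlinarith) (fun U => by
      obtain ⟨A, hA, hcell⟩ := exists_centers H (by omega : 0 < s) U
      refine ⟨A, hA.trans ?_, hcell⟩
      nlinarith) d Finset.univ (by rw [Finset.card_univ]; exact_mod_cast hsd)
  have hq := queries_le_of_confirmsWithin_univ R h hQ
  rw [Finset.card_univ] at hQc
  generalize Real.log (Fintype.card V) = L at *
  generalize (Fintype.card V : ℝ) = n at *
  generalize (H.maxDegree : ℝ) = Δ at *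
  generalize (Q.card : ℝ) = k at *
  set P := 40 * Δ ^ 2 * L with hP
  have hPd : 1 ≤ P ^ d := one_le_pow₀ hP1
  -- One more factor `P` pays for the edge queries and the set-cover logarithm, hence the exponent
  -- `d + 1`.
  have hfac : Δ + 1 + 2 * L ≤ P := by
    have h1 : Δ ≤ Δ ^ 2 * L := by nlinarith
    have h2 : L ≤ Δ ^ 2 * L := by nlinarith
    rw [hP]
    linarith
  have hsP : 1 ≤ s * P ^ d := by nlinarith
  calc (q : ℝ) ≤ n * Δ + 1 + 2 * k * L := hq
    _ ≤ n * Δ * (s * P ^ d) + n * (s * P ^ d) + 2 * (s * P ^ d * n) * L := by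
        have h1 : n * Δ ≤ n * Δ * (s * P ^ d) := le_mul_of_one_le_right (by positivity) hsP
        have h2 : 1 ≤ n * (s * P ^ d) := by nlinarith
        have h3 : 2 * k * L ≤ 2 * (s * P ^ d * n) * L := by gcongr
        linarith
    _ = n * (s * P ^ d) * (Δ + 1 + 2 * L) := by ring
    _ ≤ n * (s * P ^ d) * P := by gcongr
    _ = _ := by ring

/-! ### Asymptotic consequences -/

theorem exists_exponent_of_degree_bound {D : ℕ → ℕ} {η : ℕ → ℝ} (hη : Tendsto η atTop (𝓝 0))
    (hD : ∀ᶠ n : ℕ in atTop, (D n : ℝ) ≤ (n : ℝ) ^ η n) :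
    ∃ ε : ℕ → ℝ, Tendsto ε atTop (𝓝 0) ∧
      ∀ (V : Type u) [Fintype V] (G H : SimpleGraph V) [DecidableRel H.Adj],
        G.Connected → H.Connected → H.maxDegree ≤ D (Fintype.card V) →
        ∀ (R : GreedyRule H) (q : ℕ) (ans : Bool), (greedyVerify R).Returns G.dist q ans →
          (q : ℝ) ≤ (Fintype.card V : ℝ) ^ (1 + ε (Fintype.card V)) := by
  obtain ⟨N, hN⟩ := eventually_atTop.1 hD
  have hlim : Tendsto (fun n : ℕ => 144 * √(Real.log (Real.log n) / Real.log n + η n)) atTop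
      (𝓝 0) := by
    have h1 : Tendsto (fun y : ℝ => Real.log y / y) atTop (𝓝 0) :=
      Real.isLittleO_log_id_atTop.tendsto_div_nhds_zero
    have h2 : Tendsto (fun n : ℕ => Real.log (n : ℝ)) atTop atTop :=
      Real.tendsto_log_atTop.comp tendsto_natCast_atTop_atTop
    have h3 := ((h1.comp h2).add hη).sqrt.const_mul 144
    simpa using h3
  -- For small `n` the exponent 2 of the trivial bound `n²` suffices.
  refine ⟨fun n => if n < max N 3 then 1 else
    144 * √(Real.log (Real.log n) / Real.log n + η n), ?_, ?_⟩
  · refine hlim.congr' ?_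
    filter_upwards [eventually_ge_atTop (max N 3)] with n hn
    rw [if_neg (not_lt.2 hn)]
  · intro V _ G H _ hG hH hΔ R q ans h
    dsimp only
    split_ifs with hlt
    · have := queries_le_sq hH R h
      norm_num
      exact_mod_cast this
    · rw [not_lt, max_le_iff] at hlt
      refine (queries_le_maxDegree hH hlt.2 R h).trans ?_
      have hn3 : (3 : ℝ) ≤ Fintype.card V := by exact_mod_cast hlt.2
      have hL := log_gt_of_three_le hn3
      have hΔ1 : (1 : ℝ) ≤ H.maxDegree := by exact_mod_cast hH.one_le_maxDegree (by omega)
      refine Real.rpow_le_rpow_of_exponent_le (by linarith) ?_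
      gcongr
      rw [add_div]
      gcongr
      rw [div_le_iff₀ (by linarith), ← Real.log_rpow (by linarith)]
      refine Real.log_le_log (by linarith) (le_trans ?_ (hN _ hlt.1))
      exact_mod_cast hΔ

theorem exists_polylog_bound {D W : ℕ → ℕ} {k₁ k₂ : ℕ}
    (hD : (fun n : ℕ => (D n : ℝ)) =O[atTop] fun n : ℕ => Real.log n ^ k₁)
    (hW : (fun n : ℕ => (W n : ℝ)) =O[atTop] fun n : ℕ => Real.log n ^ k₂) :
    ∃ (k : ℕ) (C : ℝ),
      ∀ (V : Type u) [Fintype V] (G H : SimpleGraph V) [DecidableRel H.Adj],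
        G.Connected → H.Connected →
        H.maxDegree ≤ D (Fintype.card V) → treewidth H ≤ W (Fintype.card V) →
        ∀ (R : GreedyRule H) (q : ℕ) (ans : Bool), (greedyVerify R).Returns G.dist q ans →
          (q : ℝ) ≤ C * ((Fintype.card V : ℝ) * Real.log (Fintype.card V) ^ k) := by
  obtain ⟨c₁, hc₁, hD⟩ := hD.exists_pos
  obtain ⟨c₂, hc₂, hW⟩ := hW.exists_pos
  obtain ⟨N, hN⟩ := eventually_atTop.1 (hD.bound.and hW.bound)
  set M := max N 3 with hM
  set k := 2 * k₁ + k₂ + 3 with hk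
  have hl2 : 0 < Real.log 2 := Real.log_pos (by norm_num)
  -- The first summand handles `2 ≤ n < M` through `q ≤ n² ≤ M n`, the second large `n`. The
  -- exponent is `k = k₁ + (k₁ + k₂ + 1) + 2`.
  refine ⟨k, M / Real.log 2 ^ k + 36 * (c₁ * (c₁ + c₂)), ?_⟩
  intro V _ G H _ hG hH hΔ hw R q ans h
  have := hH.nonempty
  have hn := Fintype.card_pos (α := V)
  have hL0 := Real.log_natCast_nonneg (Fintype.card V)
  rcases Nat.lt_or_ge (Fintype.card V) 2 with hlt | hge
  · have h1 : Fintype.card V = 1 := by omega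
    have h2 := queries_le_choose_two hH R h
    rw [h1] at h2
    have h3 : q = 0 := by simpa using h2
    rw [h3, Nat.cast_zero]
    positivity
  rw [add_mul]
  rcases Nat.lt_or_ge (Fintype.card V) M with hlt | hgeM
  · have hq : (q : ℝ) ≤ M * Fintype.card V := by
      have := queries_le_sq hH R h
      have : q ≤ M * Fintype.card V := this.trans (by rw [sq]; gcongr)
      exact_mod_cast this
    have hlog : Real.log 2 ≤ Real.log (Fintype.card V) :=
      Real.log_le_log (by norm_num) (by exact_mod_cast hge)
    refine le_add_of_le_of_nonneg ?_ (by positivity)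
    calc (q : ℝ) ≤ M * Fintype.card V := hq
      _ = M / Real.log 2 ^ k * (Fintype.card V * Real.log 2 ^ k) := by field_simp
      _ ≤ _ := by gcongr
  · refine le_add_of_nonneg_of_le (by positivity) ?_
    have hq := queries_le_treewidth hH R h
    rw [hM, ge_iff_le, max_le_iff] at hgeM
    have hL := log_gt_of_three_le (n := Fintype.card V) (by exact_mod_cast hgeM.2)
    obtain ⟨h1, h2⟩ := hN _ hgeM.1
    rw [Real.norm_natCast, Real.norm_of_nonneg (by positivity)] at h1 h2
    have hΔ' : (H.maxDegree : ℝ) ≤ c₁ * Real.log (Fintype.card V) ^ k₁ :=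
      le_trans (by exact_mod_cast hΔ) h1
    have hw' : (treewidth H : ℝ) ≤ c₂ * Real.log (Fintype.card V) ^ k₂ :=
      le_trans (by exact_mod_cast hw) h2
    generalize Real.log (Fintype.card V) = L at *
    have hL1 : 1 ≤ L := by linarith
    have h3 : (H.maxDegree : ℝ) ≤ c₁ * L ^ (k₁ + k₂ + 1) := by
      refine hΔ'.trans (mul_le_mul_of_nonneg_left ?_ hc₁.le)
      exact pow_le_pow_right₀ hL1 (by omega)
    have h4 : (treewidth H : ℝ) * L ≤ c₂ * L ^ (k₁ + k₂ + 1) := by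
      calc (treewidth H : ℝ) * L ≤ c₂ * L ^ k₂ * L := by gcongr
        _ = c₂ * L ^ (k₂ + 1) := by ring
        _ ≤ _ := mul_le_mul_of_nonneg_left (pow_le_pow_right₀ hL1 (by omega)) hc₂.le
    calc (q : ℝ) ≤ 36 * ((H.maxDegree : ℝ) * ((H.maxDegree : ℝ) + (treewidth H : ℝ) * L) *
          (Fintype.card V : ℝ) * L ^ 2) := hq
      _ ≤ 36 * ((c₁ * L ^ k₁) * (c₁ * L ^ (k₁ + k₂ + 1) + c₂ * L ^ (k₁ + k₂ + 1)) *
          (Fintype.card V : ℝ) * L ^ 2) := by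
        gcongr
      _ = 36 * (c₁ * (c₁ + c₂)) * ((Fintype.card V : ℝ) * L ^ k) := by
        rw [hk]
        ring

theorem theorem1 :
    -- the algorithm always halts, and it answers yes exactly when the hypothetical graph is right
    (∀ (V : Type u) [Fintype V] (G H : SimpleGraph V), G.Connected → H.Connected →
      ∀ R : GreedyRule H, ∃ (q : ℕ) (ans : Bool),
        (greedyVerify R).Returns G.dist q ans ∧ (ans = true ↔ H = G)) ∧
    -- number of queries in terms of `n` and `Δ`
    (∃ C : ℝ, ∀ (V : Type u) [Fintype V] (G H : SimpleGraph V) [DecidableRel H.Adj],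
      G.Connected → H.Connected → 3 ≤ Fintype.card V →
      ∀ (R : GreedyRule H) (q : ℕ) (ans : Bool), (greedyVerify R).Returns G.dist q ans →
        (q : ℝ) ≤ (Fintype.card V : ℝ) ^ (1 + C *
          √((Real.log (Real.log (Fintype.card V)) + Real.log H.maxDegree) /
            Real.log (Fintype.card V)))) ∧
    -- it is `n ^ (1 + o(1))` when `Δ = n ^ o(1)`
    (∀ D : ℕ → ℕ,
      (∃ η : ℕ → ℝ, Tendsto η atTop (𝓝 0) ∧ ∀ᶠ n : ℕ in atTop, (D n : ℝ) ≤ (n : ℝ) ^ η n) →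
      ∃ ε : ℕ → ℝ, Tendsto ε atTop (𝓝 0) ∧
        ∀ (V : Type u) [Fintype V] (G H : SimpleGraph V) [DecidableRel H.Adj],
          G.Connected → H.Connected → H.maxDegree ≤ D (Fintype.card V) →
          ∀ (R : GreedyRule H) (q : ℕ) (ans : Bool), (greedyVerify R).Returns G.dist q ans →
            (q : ℝ) ≤ (Fintype.card V : ℝ) ^ (1 + ε (Fintype.card V))) ∧
    -- number of queries in terms of `n`, `Δ` and the treewidth
    (∃ C : ℝ, ∀ (V : Type u) [Fintype V] (G H : SimpleGraph V) [DecidableRel H.Adj],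
      G.Connected → H.Connected →
      ∀ (R : GreedyRule H) (q : ℕ) (ans : Bool), (greedyVerify R).Returns G.dist q ans →
        (q : ℝ) ≤ C * ((H.maxDegree : ℝ) *
          ((H.maxDegree : ℝ) + (treewidth H : ℝ) * Real.log (Fintype.card V)) *
          (Fintype.card V : ℝ) * Real.log (Fintype.card V) ^ 2)) ∧
    -- it is `n * polylog n` when `Δ` and the treewidth are `O(polylog n)`
    (∀ D W : ℕ → ℕ,
      (∃ k : ℕ, (fun n : ℕ => (D n : ℝ)) =O[atTop] fun n : ℕ => Real.log n ^ k) →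
      (∃ k : ℕ, (fun n : ℕ => (W n : ℝ)) =O[atTop] fun n : ℕ => Real.log n ^ k) →
      ∃ (k : ℕ) (C : ℝ),
        ∀ (V : Type u) [Fintype V] (G H : SimpleGraph V) [DecidableRel H.Adj],
          G.Connected → H.Connected →
          H.maxDegree ≤ D (Fintype.card V) → treewidth H ≤ W (Fintype.card V) →
          ∀ (R : GreedyRule H) (q : ℕ) (ans : Bool), (greedyVerify R).Returns G.dist q ans →
            (q : ℝ) ≤ C * ((Fintype.card V : ℝ) * Real.log (Fintype.card V) ^ k)) := by
  refine ⟨fun V _ G H hG hH R => greedyVerify_correct hG hH R,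
    ⟨144, fun V _ G H _ _ hH hn R q ans h => queries_le_maxDegree hH hn R h⟩, ?_,
    ⟨36, fun V _ G H _ _ hH R q ans h => queries_le_treewidth hH R h⟩, ?_⟩
  · rintro D ⟨η, hη, hD⟩
    exact exists_exponent_of_degree_bound hη hD
  · rintro D W ⟨k₁, hD⟩ ⟨k₂, hW⟩
    exact exists_polylog_bound hD hW
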